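/- Let $\mu$ be Lebesgue measure restricted to $[0,1]$, let $\mathcal C\subset L^2(\mathbb R,\mu)$ be the set of monotone maps, i.e. of those $X$ for which the support $\Gamma$ of the push-forward $(\mathrm{id},X)\#\mu$ satisfies $(m_1-m_2)(x_1-x_2)\ge 0$ for all $(m_1,x_1),(m_2,x_2)\in\Gamma$, and let $P_{\mathcal C}$ be the metric projection of $L^2(\mathbb R,\mu)$ onto $\mathcal C$. Let $\kappa\in\{1,-1\}$. Let $\bar\varrho$ be a Borel probability measure on $\mathbb R$ with finite second moment and let $\bar v\in L^2(\mathbb R,\bar\varrho)$. Then there is a unique $\bar X\in\mathcal C$ with $\bar X\#\mu=\bar\varrho$. Put $\bar V:=\bar v\circ\bar X\in L^2(\mathbb R,\mu)$ and $F[X](m):=-\kappa(2m-1)/2$. There is a unique curve $t\mapsto X_t$ such that, for all $t\in\mathbb R$, $$X_t=P_{\mathcal C}\Big(\bar X+\int_0^tY_s\,ds\Big),\qquad Y_t=\bar V+\int_0^tF[X_s]\,ds .$$ The map $t\mapsto X_t\in L^2(\mathbb R,\mu)$ is strongly differentiable for a.e. $t\in[0,\infty)$. Put $V_t:=\dot X_t$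 and $\varrho_t:=X_t\#\mu$. There is a Borel function $(t,x)\mapsto v_t(x)$ on $[0,\infty)\times\mathbb R$ such that, for a.e. $t\ge 0$, $v_t\in L^2(\mathbb R,\varrho_t)$ and $V_t=v_t\circ X_t$ $\mu$-a.e., and such that $(\varrho_t,v_t)$ is a global weak solution of the Euler–Poisson system $$\partial_t\varrho+\partial_x(\varrho v)=0,\qquad \partial_t(\varrho v)+\partial_x(\varrho v^2)=-\varrho\,\partial_xq_\varrho,\qquad \partial_{xx}^2q_\varrho=\kappa\varrho\qquad\text{in }[0,\infty)\times\mathbb R$$ with initial data $(\bar\varrho,\bar v)$, in the following sense. For all $t\ge0$, $\varrho_t$ is a Borel probability measure with finite second moment; $t\mapsto\varrho_t$ is measurable; $\int_0^T\int v_t^2\,d\varrho_t\,dt<\infty$ for all $T$. For all $t\ge0$ there is a continuous $q_t$ with $\partial^2_{xx}q_t=\kappa\varrho_t$ in the sense of distributions, whose symmetric derivative $\partial_xq_t(x)=\lim_{h\to0+}\frac{q_t(x+h)-q_t(x-h)}{2h}$ exists for every $x$ and equals $-f_t(x)$, where $$f_t(x):=-\frac{\kappa}{2}\Big(\varrho_t\big((-\infty,x)\big)+\varrho_t\big((-\infty,x]\big)-1\Big).$$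 Finally, for all restrictions $\varphi,\zeta$ to $[0,\infty)\times\mathbb R$ of functions in $C_c^\infty(\mathbb R^2)$, $$\int_0^\infty\!\!\int_{\mathbb R}\big(\partial_t\varphi+v_t\,\partial_x\varphi\big)\,d\varrho_t\,dt=-\int_{\mathbb R}\varphi(0,x)\,\bar\varrho(dx),$$ $$\int_0^\infty\!\!\int_{\mathbb R}\big(\partial_t\zeta+v_t\,\partial_x\zeta\big)v_t\,d\varrho_t\,dt+\int_0^\infty\!\!\int_{\mathbb R}\zeta f_t\,d\varrho_t\,dt=-\int_{\mathbb R}\zeta(0,x)\,\bar v(x)\,\bar\varrho(dx).$$ -/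

import Mathlib

open Set Filter Topology MeasureTheory
open scoped ENNReal ContDiff

noncomputable section

/-- The reference measure: Lebesgue measure restricted to `[0,1]`, as a Borel measure on `ℝ`. -/
abbrev refMeasure : Measure ℝ := volume.restrict (Icc (0 : ℝ) 1)

/-- The Hilbert space `L²(ℝ, μ)` for the reference measure `μ`. -/
abbrev LagL2 : Type := Lp ℝ 2 refMeasure

/-- Monotone subsets of `ℝ × ℝ`. -/
def IsMonotoneSet (Γ : Set (ℝ × ℝ)) : Prop :=
  ∀ p ∈ Γ, ∀ q ∈ Γ, 0 ≤ (p.1 - q.1) * (p.2 - q.2)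

/-- The cone of monotone maps: those `X ∈ L²(ℝ, μ)` for which the support of the transport plan
`(id, X)#μ` is a monotone set. -/
def monotoneCone : Set LagL2 :=
  {X | IsMonotoneSet (refMeasure.map (fun m : ℝ => (m, X m))).support}

/-- `P` is the metric projection of `Y` onto `C`, i.e. a point of `C` nearest to `Y`. -/
def IsMetricProjection (C : Set LagL2) (Y P : LagL2) : Prop :=
  P ∈ C ∧ ∀ Z ∈ C, ‖Y - P‖ ≤ ‖Y - Z‖

theorem memLp_lagrangianForce (κ : ℝ) :
    MemLp (fun m : ℝ => -(κ * (2 * m - 1) / 2)) 2 refMeasure := by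
  have hc : Continuous fun m : ℝ => -(κ * (2 * m - 1) / 2) := by fun_prop
  obtain ⟨B, hB⟩ := (isCompact_Icc (a := (0 : ℝ)) (b := 1)).exists_bound_of_continuousOn
    hc.continuousOn
  refine MemLp.of_bound hc.aestronglyMeasurable B ?_
  filter_upwards [ae_restrict_mem measurableSet_Icc] with m hm using hB m hm

/-- The Lagrangian force `F[X](m) = -κ (2m - 1) / 2`, which does not depend on `X`. -/
def lagrangianForce (κ : ℝ) (_X : LagL2) : LagL2 :=
  (memLp_lagrangianForce κ).toLp

/-- The modified velocity `Y_t = V̄ + ∫₀ᵗ F[X_s] ds`. -/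
def modifiedVelocity (κ : ℝ) (V₀ : LagL2) (X : ℝ → LagL2) (t : ℝ) : LagL2 :=
  V₀ + ∫ s in (0 : ℝ)..t, lagrangianForce κ (X s)

/-- `X_t` is the metric projection of `X̄ + ∫₀ᵗ Y_s ds` onto the cone of monotone maps,
for every `t`. -/
def IsProjectedFlow (κ : ℝ) (X₀ V₀ : LagL2) (X : ℝ → LagL2) : Prop :=
  ∀ t : ℝ, IsMetricProjection monotoneCone
    (X₀ + ∫ s in (0 : ℝ)..t, modifiedVelocity κ V₀ X s) (X t)

/-- Borel probability measures on `ℝ` with finite second moment. -/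
def IsP2 (ρ : Measure ℝ) : Prop :=
  IsProbabilityMeasure ρ ∧ MemLp (fun x : ℝ => x) 2 ρ

/-- `q` is a continuous solution of `∂ₓₓ q = κ ρ` on `ℝ` in the sense of distributions. -/
def IsPoissonPotential (κ : ℝ) (ρ : Measure ℝ) (q : ℝ → ℝ) : Prop :=
  Continuous q ∧ ∀ φ : ℝ → ℝ, ContDiff ℝ ∞ φ → HasCompactSupport φ →
    ∫ x, q x * deriv (deriv φ) x = κ * ∫ x, φ x ∂ρ

/-- The force density `f_ρ(x) = -(κ / 2) (ρ((-∞, x)) + ρ((-∞, x]) - 1)` with respect to `ρ`. -/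
def forceDensity (κ : ℝ) (ρ : Measure ℝ) (x : ℝ) : ℝ :=
  -(κ / 2) * (ρ.real (Iio x) + ρ.real (Iic x) - 1)

/-- `f_ρ = -∂ₓ q` at every point, for some solution `q` of `∂ₓₓ q = κ ρ`. The derivative is the
symmetric one, which at an atom of `ρ` is the mean of the one-sided derivatives. -/
def IsPoissonForce (κ : ℝ) (ρ : Measure ℝ) : Prop :=
  ∃ q : ℝ → ℝ, IsPoissonPotential κ ρ q ∧
    ∀ x : ℝ, Tendsto (fun h : ℝ => (q (x + h) - q (x - h)) / (2 * h)) (𝓝[>] 0)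
      (𝓝 (-forceDensity κ ρ x))

/-- Global weak solutions of the Euler-Poisson system
`∂ₜρ + ∂ₓ(ρ v) = 0`, `∂ₜ(ρ v) + ∂ₓ(ρ v²) = -ρ ∂ₓ q_ρ`, `∂ₓₓ q_ρ = κ ρ` in `[0, ∞) × ℝ`
with initial data `(ρ₀, v₀)`. Only the times `t ≥ 0` matter. Test functions are restrictions to
`[0, ∞) × ℝ` of smooth compactly supported functions on the plane; the first five fields give
a meaning to all the integrals. -/
structure IsWeakSolutionEP (κ : ℝ) (ρ₀ : Measure ℝ) (v₀ : ℝ → ℝ)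
    (ρ : ℝ → Measure ℝ) (v : ℝ → ℝ → ℝ) : Prop where
  isP2 : ∀ t : ℝ, 0 ≤ t → IsP2 (ρ t)
  measurable_density : Measurable fun t : Ici (0 : ℝ) => ρ t
  measurable_velocity : Measurable fun p : Ici (0 : ℝ) × ℝ => v p.1 p.2
  energy : ∀ T : ℝ, ∫⁻ t in Icc 0 T, ∫⁻ x, ‖v t x‖ₑ ^ 2 ∂(ρ t) < ⊤
  poisson : ∀ t : ℝ, 0 ≤ t → IsPoissonForce κ (ρ t)
  mass : ∀ φ : ℝ × ℝ → ℝ, ContDiff ℝ ∞ φ → HasCompactSupport φ →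
    (∫ t in Ici (0 : ℝ), ∫ x, (deriv (fun s => φ (s, x)) t
        + v t x * deriv (fun y => φ (t, y)) x) ∂(ρ t))
      = -∫ x, φ (0, x) ∂ρ₀
  momentum : ∀ ζ : ℝ × ℝ → ℝ, ContDiff ℝ ∞ ζ → HasCompactSupport ζ →
    (∫ t in Ici (0 : ℝ), ∫ x, (deriv (fun s => ζ (s, x)) t
        + v t x * deriv (fun y => ζ (t, y)) x) * v t x ∂(ρ t))
      + (∫ t in Ici (0 : ℝ), ∫ x, ζ (t, x) * forceDensity κ (ρ t) x ∂(ρ t))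
      = -∫ x, ζ (0, x) * v₀ x ∂ρ₀

end

open scoped NNReal

noncomputable section

/-! Since the force F is the same for every X, the curve to be projected is the explicit parabola
Z_t = X̄ + tV̄ + (t²/2)F, with derivative Y_t = V̄ + tF. The implicit equation therefore decouples
into one projection X_t = P_C(Z_t) per time (`isProjectedFlow_iff`), which exists and is unique
because C is a closed convex cone. P_C is a contraction, so X is locally Lipschitz with values in a
separable Hilbert space, hence differentiable almost everywhere
(`LipschitzWith.ae_differentiableAt_hilbert`).

On a level set of X_t the forward difference quotients of X are nondecreasing in m and the backward
ones nonincreasing, so V_t = Ẋ_t is constant there (`HasDerivAt.constOnLevels`) and V_t = v_t ∘ X_t.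
An explicit averaging formula for v makes it jointly Borel.

For Lipschitz g and small |c| the map X_t + c g(X_t) is still monotone. Varying c in both directions
gives Z_t − X_t ⟂ g(X_t), and by density Z_t − X_t is orthogonal to every L² function of X_t
(`IsMetricProjection.inner_comp_eq_zero`). Differentiate ⟨Z_t − X_t, φ(t, X_t)⟩ = 0. The derivative
of the second factor is again a function of X_t, so its term drops out, leaving Y_t − V_t ⟂ φ(t,
X_t). Thus V_t is the orthogonal projection of Y_t onto the functions of X_t, and V_t may be
replaced by Y_t when paired with (d/dt) ζ(t, X_t) (`inner_velocity_eq`).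

Both weak equations are then integrations by parts in time of an affine curve against a test
function along X (`integral_inner_testDeriv`): the constant 1 gives mass, Y_t gives momentum. The
force term takes its Eulerian form because the mean of 2m over the level set {X_t = x} is
ϱ_t((-∞,x)) + ϱ_t((-∞,x]) (`integral_mul_forceDensity`). -/

/-! ### Differentiability of Lipschitz curves in a Hilbert space -/

theorem Orthonormal.countable_of_separableSpace {ι H : Type*} [NormedAddCommGroup H]
    [InnerProductSpace ℝ H] [TopologicalSpace.SeparableSpace H] {b : ι → H}
    (hb : Orthonormal ℝ b) : Countable ι := by
  have h : (univ : Set ι).PairwiseDisjoint fun i => Metric.ball (b i) (1 / 2) := by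
    intro i _ j _ hij
    refine Metric.ball_disjoint_ball ?_
    rw [dist_eq_norm]
    have h2 : ‖b i - b j‖ ^ 2 = 2 := by
      rw [norm_sub_sq_real, hb.1 i, hb.1 j, hb.2 hij]; norm_num
    nlinarith [norm_nonneg (b i - b j)]
  exact Set.countable_univ_iff.mp <| h.countable_of_isOpen (fun i _ => Metric.isOpen_ball)
    fun i _ => Metric.nonempty_ball.mpr (by norm_num)

/-- A Lipschitz curve in a separable real Hilbert space is differentiable almost everywhere. -/
theorem LipschitzWith.ae_differentiableAt_hilbert {H : Type*} [NormedAddCommGroup H]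
    [InnerProductSpace ℝ H] [CompleteSpace H] [TopologicalSpace.SeparableSpace H] {K : ℝ≥0}
    {f : ℝ → H} (hf : LipschitzWith K f) : ∀ᵐ t, DifferentiableAt ℝ f t := by
  obtain ⟨ι, b, hb⟩ : ∃ (ι : Set H) (b : HilbertBasis ι ℝ H), ⇑b = Subtype.val :=
    exists_hilbertBasis ℝ H
  have : Countable ι := b.orthonormal.countable_of_separableSpace
  have hlip (i : ι) : LipschitzWith K fun s => inner ℝ (b i) (f s) := by
    refine LipschitzWith.of_dist_le_mul fun s t => ?_
    rw [Real.dist_eq, ← inner_sub_right]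
    refine (abs_real_inner_le_norm _ _).trans ?_
    rw [b.orthonormal.1 i, one_mul, ← dist_eq_norm]
    exact hf.dist_le_mul s t
  set u : ι → ℝ → ℝ := fun i => deriv fun s => inner ℝ (b i) (f s)
  have hdiff : ∀ᵐ t, ∀ i, DifferentiableAt ℝ (fun s => inner ℝ (b i) (f s)) t :=
    ae_all_iff.mpr fun i => (hlip i).ae_differentiableAt_real
  -- Bessel's inequality for the difference quotients, whose norms are at most K, passes to the
  -- limit on finite sets of coordinates. The coordinate derivatives are therefore square-summable
  -- and assemble into a vector of norm at most K.
  have hw : ∀ᵐ t, ∃ w : H, (∀ i, inner ℝ (b i) w = u i t) ∧ ‖w‖ ≤ K := by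
    filter_upwards [hdiff] with t ht
    have hbd (s : Finset ι) : ∑ i ∈ s, ‖u i t‖ ^ 2 ≤ (K : ℝ) ^ 2 := by
      have hlim : Tendsto (fun h : ℝ => ∑ i ∈ s,
          ‖inner ℝ (b i) (slope f t h)‖ ^ 2) (𝓝[≠] t) (𝓝 (∑ i ∈ s, ‖u i t‖ ^ 2)) := by
        refine tendsto_finsetSum _ fun i _ => ?_
        have := hasDerivAt_iff_tendsto_slope.mp (ht i).hasDerivAt
        refine Tendsto.congr (fun h => ?_) (this.norm.pow 2)
        simp only [slope, vsub_eq_sub, inner_smul_right, inner_sub_right, smul_eq_mul]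
      refine le_of_tendsto hlim (Eventually.of_forall fun h => ?_)
      refine (b.orthonormal.sum_inner_products_le _).trans ?_
      gcongr
      rw [slope_def_module, norm_smul, norm_inv, ← div_eq_inv_mul]
      refine div_le_of_le_mul₀ (norm_nonneg _) K.2 ?_
      simpa [dist_eq_norm] using hf.dist_le_mul h t
    have hmem : Memℓp (fun i => u i t) 2 := memℓp_gen' (C := (K : ℝ) ^ 2) (by simpa using hbd)
    set w := b.repr.symm ⟨fun i => u i t, hmem⟩ with hwdef
    have hi (i : ι) : inner ℝ (b i) w = u i t := by
      rw [← b.repr_apply_apply, hwdef, LinearIsometryEquiv.apply_symm_apply]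
    refine ⟨w, hi, ?_⟩
    have hsum : ∑' i, ‖u i t‖ ^ 2 ≤ (K : ℝ) ^ 2 :=
      Real.tsum_le_of_sum_le (fun i => by positivity) hbd
    have hnorm : ‖w‖ ^ 2 = ∑' i, ‖u i t‖ ^ 2 := by
      rw [← real_inner_self_eq_norm_sq, ← b.tsum_inner_mul_inner w w]
      refine tsum_congr fun i => ?_
      rw [real_inner_comm, hi, Real.norm_eq_abs, sq_abs, sq]
    exact abs_le_of_sq_le_sq' (hnorm.trans_le hsum) K.2 |>.2
  choose! w hw using fun t (h : ∃ w : H, (∀ i, inner ℝ (b i) w = u i t) ∧ ‖w‖ ≤ K) => h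
  rename_i hex
  have hwi : ∀ᵐ t, (∀ i, inner ℝ (b i) (w t) = u i t) ∧ ‖w t‖ ≤ K := by
    filter_upwards [hex] with t ht using hw t ht
  have hmeas : AEStronglyMeasurable w volume := by
    refine aestronglyMeasurable_of_tendsto_ae (atTop : Filter (Finset ι))
      (f := fun s t => ∑ i ∈ s, u i t • b i) (fun s => ?_) ?_
    · refine Finset.aestronglyMeasurable_fun_sum _ fun i _ => ?_
      exact ((measurable_deriv _).stronglyMeasurable.smul_const _).aestronglyMeasurable
    · filter_upwards [hwi] with t ht
      have := b.hasSum_repr (w t)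
      simp only [b.repr_apply_apply, ht.1] at this
      exact this
  have hloc : LocallyIntegrable w volume := by
    rw [locallyIntegrable_iff]
    intro k hk
    refine Measure.integrableOn_of_bounded (M := K) hk.measure_lt_top.ne hmeas ?_
    exact ae_restrict_of_ae (hwi.mono fun t ht => ht.2)
  have hint (x y : ℝ) : IntervalIntegrable w volume x y := 
    intervalIntegrable_iff.mpr <|
      (hloc.integrableOn_isCompact isCompact_uIcc).mono_set uIoc_subset_uIcc
  -- Each coordinate is absolutely continuous, so f is the Bochner primitive of w. Lebesgue
  -- differentiation then upgrades coordinatewise derivatives to a strong derivative.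
  have hf_eq (t : ℝ) : f t = f 0 + ∫ s in (0 : ℝ)..t, w s := by
    have : ∀ i, inner ℝ (b i) (f t - f 0) = inner ℝ (b i) (∫ s in (0 : ℝ)..t, w s) := by
      intro i
      have h1 : ∫ s in (0 : ℝ)..t, inner ℝ (b i) (w s) = inner ℝ (b i) (∫ s in (0 : ℝ)..t, w s) :=
        (innerSL ℝ (b i)).intervalIntegral_comp_comm (hint 0 t)
      rw [← h1, inner_sub_right]
      have h2 := ((hlip i).lipschitzOnWith (s := uIcc 0
        t)).absolutelyContinuousOnInterval.integral_deriv_eq_sub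
      rw [← h2]
      refine intervalIntegral.integral_congr_ae ?_
      filter_upwards [hwi] with s hs _ using (hs.1 i).symm
    rw [← sub_eq_iff_eq_add']
    apply b.repr.injective
    ext i
    rw [b.repr_apply_apply, b.repr_apply_apply, this]
  filter_upwards [_root_.LocallyIntegrable.ae_hasDerivAt_integral hloc] with t ht
  have := ((ht 0).const_add (f 0)).differentiableAt
  rwa [← funext hf_eq] at this

/-- Composing with the retraction onto [-n, n] gives a globally Lipschitz curve that agrees with f
on the open interval. -/
theorem ae_differentiableAt_of_lipschitzOn_Icc {H : Type*} [NormedAddCommGroup H]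
    [InnerProductSpace ℝ H] [CompleteSpace H] [TopologicalSpace.SeparableSpace H] {f : ℝ → H}
    (hf : ∀ n : ℕ, ∃ K : ℝ≥0, LipschitzOnWith K f (Icc (-(n : ℝ)) n)) :
    ∀ᵐ t, DifferentiableAt ℝ f t := by
  have key : ∀ n : ℕ, ∀ᵐ t, t ∈ Ioo (-(n : ℝ)) n → DifferentiableAt ℝ f t := by
    intro n
    obtain ⟨K, hK⟩ := hf n
    have hn : -(n : ℝ) ≤ n := by linarith [n.cast_nonneg (α := ℝ)]
    have h1 : LipschitzWith K (fun t => f (projIcc (-(n : ℝ)) n hn t)) := by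
      have := hK.to_restrict.comp (LipschitzWith.projIcc hn)
      rwa [mul_one] at this
    filter_upwards [h1.ae_differentiableAt_hilbert] with t ht htn
    refine ht.congr_of_eventuallyEq ?_
    filter_upwards [isOpen_Ioo.mem_nhds htn] with s hs
    rw [projIcc_of_mem hn (Ioo_subset_Icc_self hs)]
  filter_upwards [ae_all_iff.mpr key] with t ht
  obtain ⟨n, hn⟩ := exists_nat_gt |t|
  exact ht n (abs_lt.mp hn)

/-! ### The cone of monotone maps -/

theorem ae_refMeasure_mem_Ioo : ∀ᵐ m ∂refMeasure, m ∈ Ioo (0 : ℝ) 1 := by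
  rw [refMeasure, ← Measure.restrict_congr_set (Ioo_ae_eq_Icc (a := (0 : ℝ)) (b := 1) (μ := volume))]
  exact ae_restrict_mem measurableSet_Ioo

instance : IsProbabilityMeasure refMeasure := ⟨by simp⟩

/-- `X` is monotone on a subset of full reference measure of `(0, 1)`. -/
def AEMonotone (X : ℝ → ℝ) : Prop :=
  ∃ S : Set ℝ, (∀ᵐ m ∂refMeasure, m ∈ S) ∧ S ⊆ Ioo 0 1 ∧ MonotoneOn X S

theorem AEMonotone.of_monotoneOn {X : ℝ → ℝ} {S : Set ℝ} (hS : ∀ᵐ m ∂refMeasure, m ∈ S)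
    (hX : MonotoneOn X S) : AEMonotone X :=
  ⟨S ∩ Ioo 0 1, hS.and ae_refMeasure_mem_Ioo, inter_subset_right, hX.mono inter_subset_left⟩

theorem AEMonotone.congr {X Y : ℝ → ℝ} (hX : AEMonotone X) (h : X =ᵐ[refMeasure] Y) :
    AEMonotone Y := by
  obtain ⟨S, hS, -, hm⟩ := hX
  refine .of_monotoneOn (S := S ∩ {m | X m = Y m}) (hS.and h) fun a ha b hb hab => ?_
  rw [← ha.2, ← hb.2]
  exact hm ha.1 hb.1 hab

theorem AEMonotone.add {X Y : ℝ → ℝ} (hX : AEMonotone X) (hY : AEMonotone Y) :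
    AEMonotone (X + Y) := by
  obtain ⟨S, hS, -, hSm⟩ := hX
  obtain ⟨T, hT, -, hTm⟩ := hY
  exact .of_monotoneOn (S := S ∩ T) (hS.and hT) fun a ha b hb hab =>
    add_le_add (hSm ha.1 hb.1 hab) (hTm ha.2 hb.2 hab)

theorem AEMonotone.comp {X f : ℝ → ℝ} (hf : Monotone f) (hX : AEMonotone X) :
    AEMonotone (f ∘ X) := by
  obtain ⟨S, hS, -, hSm⟩ := hX
  exact .of_monotoneOn hS (hf.comp_monotoneOn hSm)

theorem Lp.aemeasurable_refMeasure (X : LagL2) : AEMeasurable X refMeasure :=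
  (Lp.aestronglyMeasurable X).aemeasurable

/-- Almost every graph point lies in the support of the plan, which gives one direction. For the
other, violating monotonicity is an open condition on pairs, and every neighbourhood of a support
point contains graph points over the full set S. -/
theorem mem_monotoneCone_iff {X : LagL2} : X ∈ monotoneCone ↔ AEMonotone X := by
  have hmeas : AEMeasurable (fun m : ℝ => (m, X m)) refMeasure :=
    aemeasurable_id.prodMk (Lp.aemeasurable_refMeasure X)
  constructor
  · intro h
    have h1 : ∀ᵐ m ∂refMeasure, (m, X m) ∈
        (refMeasure.map (fun m : ℝ => (m, X m))).support :=
      ae_of_ae_map hmeas Measure.support_mem_ae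
    refine .of_monotoneOn h1 fun a ha b hb hab => ?_
    rcases hab.eq_or_lt with rfl | hab
    · exact le_rfl
    · have := h _ hb _ ha
      exact sub_nonneg.mp (nonneg_of_mul_nonneg_right this (sub_pos.mpr hab))
  · rintro ⟨S, hS, -, hm⟩ p hp q hq
    by_contra! hneg
    have hopen : IsOpen {z : (ℝ × ℝ) × (ℝ × ℝ) | (z.1.1 - z.2.1) * (z.1.2 - z.2.2) < 0} :=
      isOpen_lt (by fun_prop) continuous_const
    obtain ⟨U, V, hU, hV, hpU, hqV, hUV⟩ := isOpen_prod_iff.mp hopen p q hneg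
    have key {W : Set (ℝ × ℝ)} {z : ℝ × ℝ} (hW : IsOpen W) (hz : z ∈ W)
        (hzs : z ∈ (refMeasure.map (fun m : ℝ => (m, X m))).support) :
        ∃ m ∈ S, (m, X m) ∈ W := by
      have hpos := (Measure.mem_support_iff_forall z).mp hzs W (hW.mem_nhds hz)
      rw [Measure.map_apply_of_aemeasurable hmeas hW.measurableSet] at hpos
      obtain ⟨m, hm1, hm2⟩ := (frequently_ae_iff.mpr hpos.ne' : ∃ᵐ m ∂refMeasure,
        (m, X m) ∈ W).and_eventually hS |>.exists
      exact ⟨m, hm2, hm1⟩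
    obtain ⟨m, hmS, hmU⟩ := key hU hpU hp
    obtain ⟨n, hnS, hnV⟩ := key hV hqV hq
    have hlt : (m - n) * (X m - X n) < 0 := hUV (mk_mem_prod hmU hnV)
    rcases le_total m n with h | h
    · nlinarith [hm hmS hnS h]
    · nlinarith [hm hnS hmS h]

theorem add_mem_monotoneCone {X Y : LagL2} (hX : X ∈ monotoneCone) (hY : Y ∈ monotoneCone) :
    X + Y ∈ monotoneCone := by
  rw [mem_monotoneCone_iff] at *
  exact (hX.add hY).congr (Lp.coeFn_add X Y).symm

theorem smul_mem_monotoneCone {X : LagL2} (hX : X ∈ monotoneCone) {c : ℝ} (hc : 0 ≤ c) :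
    c • X ∈ monotoneCone := by
  rw [mem_monotoneCone_iff] at *
  exact (hX.comp (f := fun x => c * x) (monotone_mul_left_of_nonneg hc)).congr
    (Lp.coeFn_smul c X).symm

theorem zero_mem_monotoneCone : (0 : LagL2) ∈ monotoneCone := by
  rw [mem_monotoneCone_iff]
  refine AEMonotone.congr (X := 0) ?_ (Lp.coeFn_zero ℝ 2 refMeasure).symm
  exact .of_monotoneOn (S := univ) (by simp) fun _ _ _ _ _ => le_rfl

theorem convex_monotoneCone : Convex ℝ monotoneCone := fun _ hX _ hY _ _ ha hb _ =>
  add_mem_monotoneCone (smul_mem_monotoneCone hX ha) (smul_mem_monotoneCone hY hb)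

theorem exists_seq_tendsto_ae_of_tendsto_Lp {f : ℕ → LagL2} {g : LagL2}
    (h : Tendsto f atTop (𝓝 g)) : ∃ ns : ℕ → ℕ, StrictMono ns ∧
      ∀ᵐ m ∂refMeasure, Tendsto (fun i => f (ns i) m) atTop (𝓝 (g m)) :=
  (tendstoInMeasure_of_tendsto_Lp h).exists_seq_tendsto_ae

theorem isClosed_monotoneCone : IsClosed monotoneCone := by
  refine IsSeqClosed.isClosed fun f g hf hfg => ?_
  obtain ⟨ns, -, hns⟩ := exists_seq_tendsto_ae_of_tendsto_Lp hfg
  simp only [mem_monotoneCone_iff] at *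
  choose S hS _ hm using hf
  refine .of_monotoneOn (S := {m | Tendsto (fun i => f (ns i) m) atTop (𝓝 (g m))} ∩ ⋂ n, S n)
    ?_ fun a ha b hb hab => ?_
  · filter_upwards [hns, ae_all_iff.mpr hS] with m h1 h2 using ⟨h1, mem_iInter.mpr h2⟩
  · exact le_of_tendsto_of_tendsto' ha.1 hb.1 fun i =>
      hm _ (mem_iInter.mp ha.2 _) (mem_iInter.mp hb.2 _) hab

/-! ### Metric projection onto the cone -/

theorem isMetricProjection_iff {Y P : LagL2} : IsMetricProjection monotoneCone Y P ↔
    P ∈ monotoneCone ∧ ∀ Z ∈ monotoneCone, inner ℝ (Y - P) (Z - P) ≤ 0 := by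
  refine and_congr_right fun hP => ?_
  rw [← norm_eq_iInf_iff_real_inner_le_zero convex_monotoneCone hP]
  have : Nonempty monotoneCone := ⟨⟨P, hP⟩⟩
  have hbdd : BddBelow (range fun w : monotoneCone => ‖Y - w‖) :=
    ⟨0, forall_mem_range.2 fun _ => norm_nonneg _⟩
  constructor
  · intro h
    exact le_antisymm (le_ciInf fun w => h w w.2) (ciInf_le hbdd ⟨P, hP⟩)
  · intro h Z hZ
    rw [h]
    exact ciInf_le hbdd ⟨Z, hZ⟩

theorem exists_isMetricProjection (Y : LagL2) : ∃ P, IsMetricProjection monotoneCone Y P := by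
  obtain ⟨P, hP, h⟩ := exists_norm_eq_iInf_of_complete_convex ⟨0, zero_mem_monotoneCone⟩
    isClosed_monotoneCone.isComplete convex_monotoneCone Y
  rw [norm_eq_iInf_iff_real_inner_le_zero convex_monotoneCone hP] at h
  exact ⟨P, isMetricProjection_iff.mpr ⟨hP, h⟩⟩

/-- Adding the two variational inequalities, each tested with the other projection, gives ‖P − Q‖² ≤
⟨Y − Z, P − Q⟩. -/
theorem IsMetricProjection.norm_sub_le {Y P Z Q : LagL2}
    (hP : IsMetricProjection monotoneCone Y P) (hQ : IsMetricProjection monotoneCone Z Q) :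
    ‖P - Q‖ ≤ ‖Y - Z‖ := by
  rw [isMetricProjection_iff] at hP hQ
  have h1 := hP.2 Q hQ.1
  have h2 := hQ.2 P hP.1
  have h3 : inner ℝ (P - Q) (P - Q) ≤ inner ℝ (Y - Z) (P - Q) := by
    have : inner ℝ (Y - Z) (P - Q) - inner ℝ (P - Q) (P - Q) =
        -(inner ℝ (Y - P) (Q - P) + inner ℝ (Z - Q) (P - Q)) := by
      rw [← neg_sub P Q, inner_neg_right, ← inner_sub_left]
      rw [show Y - Z - (P - Q) = (Y - P) - (Z - Q) by abel, inner_sub_left]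
      ring
    linarith
  have h4 := real_inner_le_norm (Y - Z) (P - Q)
  rw [real_inner_self_eq_norm_mul_norm] at h3
  by_contra! hlt
  have : 0 < ‖P - Q‖ := (norm_nonneg _).trans_lt hlt
  nlinarith

theorem IsMetricProjection.eq {Y P Q : LagL2} (hP : IsMetricProjection monotoneCone Y P)
    (hQ : IsMetricProjection monotoneCone Y Q) : P = Q := by
  have := hP.norm_sub_le hQ
  rw [sub_self, norm_zero] at this
  exact sub_eq_zero.mp (norm_le_zero_iff.mp this)

theorem IsMetricProjection.eq_of_mem {Y P : LagL2} (hP : IsMetricProjection monotoneCone Y P)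
    (hY : Y ∈ monotoneCone) : P = Y :=
  hP.eq ⟨hY, fun Z _ => by simp⟩

/-- The cone contains 0 and 2P, which test the variational inequality in the directions −P and P. -/
theorem IsMetricProjection.inner_self {Y P : LagL2} (hP : IsMetricProjection monotoneCone Y P) :
    inner ℝ (Y - P) P = 0 := by
  rw [isMetricProjection_iff] at hP
  have h1 := hP.2 0 zero_mem_monotoneCone
  have h2 := hP.2 (P + P) (add_mem_monotoneCone hP.1 hP.1)
  rw [zero_sub, inner_neg_right] at h1
  rw [add_sub_cancel_right] at h2
  linarith

theorem IsMetricProjection.inner_le_zero {Y P Z : LagL2}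
    (hP : IsMetricProjection monotoneCone Y P) (hZ : Z ∈ monotoneCone) :
    inner ℝ (Y - P) Z ≤ 0 := by
  have h1 := (isMetricProjection_iff.mp hP).2 Z hZ
  rw [inner_sub_right, hP.inner_self] at h1
  linarith

theorem IsMetricProjection.inner_eq_zero {Y P W : LagL2}
    (hP : IsMetricProjection monotoneCone Y P) {ε : ℝ} (hε : 0 < ε)
    (h1 : P + ε • W ∈ monotoneCone) (h2 : P - ε • W ∈ monotoneCone) :
    inner ℝ (Y - P) W = 0 := by
  have h1 := hP.inner_le_zero h1
  have h2 := hP.inner_le_zero h2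
  rw [inner_add_right, hP.inner_self, inner_smul_right] at h1
  rw [inner_sub_right, hP.inner_self, inner_smul_right] at h2
  nlinarith

/-! ### Monotone maps and their laws -/

theorem refMeasure_real_Iic {m : ℝ} (h0 : 0 ≤ m) (h1 : m ≤ 1) : refMeasure.real (Iic m) = m := by
  have : Iic m ∩ Icc 0 1 = Icc 0 m := by
    ext y
    simp only [mem_inter_iff, mem_Iic, mem_Icc]
    constructor
    · exact fun h => ⟨h.2.1, h.1⟩
    · exact fun h => ⟨h.2, h.1, h.2.trans h1⟩
  rw [measureReal_restrict_apply measurableSet_Iic, this, Real.volume_real_Icc_of_le h0, sub_zero]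

theorem refMeasure_real_Iio {m : ℝ} (h0 : 0 ≤ m) (h1 : m ≤ 1) : refMeasure.real (Iio m) = m := by
  rw [measureReal_congr Iio_ae_eq_Iic, refMeasure_real_Iic h0 h1]

theorem le_refMeasure_real {S T : Set ℝ} (hS : ∀ᵐ m ∂refMeasure, m ∈ S) {m : ℝ}
    (hm : m ∈ Ioo (0 : ℝ) 1) (h : ∀ y ∈ S, y ≤ m → y ∈ T) : m ≤ refMeasure.real T := by
  rw [← refMeasure_real_Iic hm.1.le hm.2.le]
  refine ENNReal.toReal_mono (measure_ne_top _ _) (measure_mono_ae ?_)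
  filter_upwards [hS] with y hy hym using h y hy hym

theorem refMeasure_real_le {S T : Set ℝ} (hS : ∀ᵐ m ∂refMeasure, m ∈ S) {m : ℝ}
    (hm : m ∈ Ioo (0 : ℝ) 1) (h : ∀ y ∈ S, y ∈ T → y ≤ m) : refMeasure.real T ≤ m := by
  refine le_of_le_of_eq ?_ (refMeasure_real_Iic hm.1.le hm.2.le)
  refine ENNReal.toReal_mono (measure_ne_top _ _) (measure_mono_ae ?_)
  filter_upwards [hS] with y hy hym using h y hy hym

section levels

variable {X : ℝ → ℝ} {S : Set ℝ}

/-- In this and the next three lemmas, a sublevel set of a monotone map is almost an initial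
interval of [0,1]. Its mass is therefore compared with m according to whether m belongs to it. -/
theorem le_measure_Iic_of_le (hX : AEMeasurable X refMeasure)
    (hS : ∀ᵐ m ∂refMeasure, m ∈ S) (hS' : S ⊆ Ioo 0 1) (hm : MonotoneOn X S) {m x : ℝ}
    (hmS : m ∈ S) (h : X m ≤ x) : m ≤ (refMeasure.map X).real (Iic x) := by
  rw [map_measureReal_apply_of_aemeasurable hX measurableSet_Iic]
  exact le_refMeasure_real hS (hS' hmS) fun y hy hym => (hm hy hmS hym).trans h

theorem measure_Iic_le_of_lt (hX : AEMeasurable X refMeasure)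
    (hS : ∀ᵐ m ∂refMeasure, m ∈ S) (hS' : S ⊆ Ioo 0 1) (hm : MonotoneOn X S) {m x : ℝ}
    (hmS : m ∈ S) (h : x < X m) : (refMeasure.map X).real (Iic x) ≤ m := by
  rw [map_measureReal_apply_of_aemeasurable hX measurableSet_Iic]
  refine refMeasure_real_le hS (hS' hmS) fun y hy hyT => ?_
  by_contra! hlt
  exact absurd (hm hmS hy hlt.le) (not_le.mpr (lt_of_le_of_lt hyT h))

theorem le_measure_Iio_of_lt (hX : AEMeasurable X refMeasure)
    (hS : ∀ᵐ m ∂refMeasure, m ∈ S) (hS' : S ⊆ Ioo 0 1) (hm : MonotoneOn X S) {m x : ℝ}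
    (hmS : m ∈ S) (h : X m < x) : m ≤ (refMeasure.map X).real (Iio x) := by
  rw [map_measureReal_apply_of_aemeasurable hX measurableSet_Iio]
  exact le_refMeasure_real hS (hS' hmS) fun y hy hym => (hm hy hmS hym).trans_lt h

theorem measure_Iio_le_of_le (hX : AEMeasurable X refMeasure)
    (hS : ∀ᵐ m ∂refMeasure, m ∈ S) (hS' : S ⊆ Ioo 0 1) (hm : MonotoneOn X S) {m x : ℝ}
    (hmS : m ∈ S) (h : x ≤ X m) : (refMeasure.map X).real (Iio x) ≤ m := by
  rw [map_measureReal_apply_of_aemeasurable hX measurableSet_Iio]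
  refine refMeasure_real_le hS (hS' hmS) fun y hy hyT => ?_
  by_contra! hlt
  exact absurd (hm hmS hy hlt.le) (not_le.mpr (lt_of_lt_of_le hyT h))

end levels

/-- Monotone maps are determined by their law. -/
theorem AEMonotone.ae_eq_of_map_eq {X Y : ℝ → ℝ} (hX : AEMonotone X) (hY : AEMonotone Y)
    (hXm : AEMeasurable X refMeasure) (hYm : AEMeasurable Y refMeasure)
    (h : refMeasure.map X = refMeasure.map Y) : X =ᵐ[refMeasure] Y := by
  obtain ⟨S, hS, hS', hSm⟩ := hX
  obtain ⟨T, hT, hT', hTm⟩ := hY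
  -- A rational q strictly between X m and Y m forces m to equal the common distribution function at
  -- q, which happens for only countably many m.
  have hne : ∀ᵐ m ∂refMeasure, ∀ x : ℚ, m ≠ (refMeasure.map X).real (Iic (x : ℝ)) :=
    ae_all_iff.mpr fun x => Measure.ae_ne refMeasure _
  filter_upwards [hS, hT, hne] with m hmS hmT hm
  refine le_antisymm (le_of_forall_rat_lt_imp_le fun q hq => ?_)
    (le_of_forall_rat_lt_imp_le fun q hq => ?_)
  · by_contra! hlt
    have h1 := measure_Iic_le_of_lt hXm hS hS' hSm hmS hq
    have h2 := le_measure_Iic_of_le hYm hT hT' hTm hmT hlt.le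
    exact hm q (le_antisymm (h ▸ h2) h1)
  · by_contra! hlt
    have h1 := measure_Iic_le_of_lt hYm hT hT' hTm hmT hq
    have h2 := le_measure_Iic_of_le hXm hS hS' hSm hmS hlt.le
    exact hm q (le_antisymm h2 (h ▸ h1))

open ProbabilityTheory in
-- Q is the quantile function. Right continuity of the distribution function yields the Galois
-- relation `hgal`, so {Q ≤ x} is, up to a null set, an initial interval of length `cdf ρ x`.
theorem exists_monotoneOn_map_eq (ρ : Measure ℝ) [IsProbabilityMeasure ρ] :
    ∃ Q : ℝ → ℝ, MonotoneOn Q (Ioo 0 1) ∧ AEMeasurable Q refMeasure ∧ refMeasure.map Q = ρ := by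
  set Q : ℝ → ℝ := fun m => sInf {x | m ≤ cdf ρ x}
  have hbdd {m : ℝ} (hm : m ∈ Ioo (0 : ℝ) 1) : BddBelow {x | m ≤ cdf ρ x} := by
    obtain ⟨a, ha⟩ := ((tendsto_cdf_atBot ρ).eventually_lt_const hm.1).exists
    refine ⟨a, fun x hx => ?_⟩
    by_contra! hlt
    exact absurd (hx.trans (monotone_cdf ρ hlt.le)) (not_le.mpr ha)
  have hne {m : ℝ} (hm : m ∈ Ioo (0 : ℝ) 1) : {x | m ≤ cdf ρ x}.Nonempty := by
    obtain ⟨a, ha⟩ := ((tendsto_cdf_atTop ρ).eventually_const_lt hm.2).exists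
    exact ⟨a, ha.le⟩
  have hgal {m : ℝ} (hm : m ∈ Ioo (0 : ℝ) 1) (x : ℝ) : Q m ≤ x ↔ m ≤ cdf ρ x := by
    refine ⟨fun h => ?_, fun h => csInf_le (hbdd hm) h⟩
    refine ge_of_tendsto (((cdf ρ).right_continuous x).tendsto.mono_left
      (nhdsWithin_mono x Ioi_subset_Ici_self)) ?_
    filter_upwards [self_mem_nhdsWithin] with y hy
    obtain ⟨z, hz, hzy⟩ := (csInf_lt_iff (hbdd hm) (hne hm)).mp (h.trans_lt hy)
    exact le_trans hz (monotone_cdf ρ hzy.le)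
  have hmono : MonotoneOn Q (Ioo 0 1) := fun a ha b hb hab =>
    (hgal ha _).mpr (hab.trans ((hgal hb _).mp le_rfl))
  have hmeas : AEMeasurable Q refMeasure := by
    rw [refMeasure,
      ← Measure.restrict_congr_set (Ioo_ae_eq_Icc (a := (0 : ℝ)) (b := 1) (μ := volume))]
    exact aemeasurable_restrict_of_monotoneOn measurableSet_Ioo hmono
  refine ⟨Q, hmono, hmeas, ?_⟩
  have := Measure.isProbabilityMeasure_map hmeas
  refine Measure.ext_of_Iic _ _ fun x => ?_
  rw [← measureReal_eq_measureReal_iff, map_measureReal_apply_of_aemeasurable hmeas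
    measurableSet_Iic, ← cdf_eq_real, ← refMeasure_real_Iic (cdf_nonneg ρ x) (cdf_le_one ρ x)]
  refine measureReal_congr ?_
  filter_upwards [ae_refMeasure_mem_Ioo] with m hm
  exact propext (hgal hm x)

theorem existsUnique_monotone_transport {ρ : Measure ℝ} (hρ : IsP2 ρ) :
    ∃! X : LagL2, X ∈ monotoneCone ∧ refMeasure.map X = ρ := by
  have := hρ.1
  obtain ⟨Q, hQ, hQm, hmap⟩ := exists_monotoneOn_map_eq ρ
  have hmem : MemLp Q 2 refMeasure := by
    have h := hρ.2
    rw [← hmap] at h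
    exact (memLp_map_measure_iff aestronglyMeasurable_id hQm).mp h
  have hcoe := hmem.coeFn_toLp
  refine ⟨hmem.toLp, ⟨mem_monotoneCone_iff.mpr ?_, ?_⟩, ?_⟩
  · exact (AEMonotone.of_monotoneOn ae_refMeasure_mem_Ioo hQ).congr hcoe.symm
  · rw [Measure.map_congr hcoe, hmap]
  · rintro Y ⟨hY, hYmap⟩
    refine Lp.ext (AEMonotone.ae_eq_of_map_eq (mem_monotoneCone_iff.mp hY) ?_
      (Lp.aemeasurable_refMeasure Y) (Lp.aemeasurable_refMeasure _) ?_)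
    · exact (AEMonotone.of_monotoneOn ae_refMeasure_mem_Ioo hQ).congr hcoe.symm
    · rw [hYmap, Measure.map_congr hcoe, hmap]

/-! ### Velocities are functions of position -/

/-- Where Y is constant, Z n − Y differs from the monotone Z n by a constant. Being nondecreasing
survives nonnegative factors and almost everywhere limits along a subsequence. -/
theorem exists_full_set_le_of_tendsto {Z : ℕ → LagL2} {Y V : LagL2} {c : ℕ → ℝ}
    (hc : ∀ n, 0 ≤ c n) (hZ : ∀ n, Z n ∈ monotoneCone)
    (h : Tendsto (fun n => c n • (Z n - Y)) atTop (𝓝 V)) :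
    ∃ S : Set ℝ, (∀ᵐ m ∂refMeasure, m ∈ S) ∧
      ∀ a ∈ S, ∀ b ∈ S, a ≤ b → Y a = Y b → V a ≤ V b := by
  obtain ⟨ns, -, hns⟩ := exists_seq_tendsto_ae_of_tendsto_Lp h
  simp only [mem_monotoneCone_iff] at hZ
  choose S hS _ hm using hZ
  have hcoe : ∀ᵐ m ∂refMeasure, ∀ n, (c n • (Z n - Y) : LagL2) m = c n * (Z n m - Y m) := by
    refine ae_all_iff.mpr fun n => ?_
    filter_upwards [Lp.coeFn_smul (c n) (Z n - Y), Lp.coeFn_sub (Z n) Y] with m h1 h2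
    rw [h1, Pi.smul_apply, h2, Pi.sub_apply, smul_eq_mul]
  refine ⟨{m | Tendsto (fun i => (c (ns i) • (Z (ns i) - Y) : LagL2) m) atTop (𝓝 (V m)) ∧
    (∀ n, (c n • (Z n - Y) : LagL2) m = c n * (Z n m - Y m)) ∧ ∀ n, m ∈ S n},
    hns.and (hcoe.and (ae_all_iff.mpr hS)), fun a ha b hb hab hY => ?_⟩
  refine le_of_tendsto_of_tendsto' ha.1 hb.1 fun i => ?_
  rw [ha.2.1, hb.2.1, hY]
  exact mul_le_mul_of_nonneg_left
    (sub_le_sub_right (hm _ (ha.2.2 _) (hb.2.2 _) hab) _) (hc _)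

/-- `V` is constant on the level sets of `X` up to a null set. -/
def ConstOnLevels (X V : ℝ → ℝ) : Prop :=
  ∃ S : Set ℝ, (∀ᵐ m ∂refMeasure, m ∈ S) ∧ ∀ a ∈ S, ∀ b ∈ S, X a = X b → V a = V b

/-- The velocity of a curve of monotone maps is constant on the level sets. -/
theorem HasDerivAt.constOnLevels {X : ℝ → LagL2} {V : LagL2} {t : ℝ}
    (hX : ∀ s, X s ∈ monotoneCone) (h : HasDerivAt X V t) : ConstOnLevels (X t) V := by
  have hslope := hasDerivAt_iff_tendsto_slope_zero.mp h
  have hlim : Tendsto (fun n : ℕ => 1 / ((n : ℝ) + 1)) atTop (𝓝[≠] 0) :=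
    tendsto_nhdsWithin_iff.mpr ⟨tendsto_one_div_add_atTop_nhds_zero_nat,
      Eventually.of_forall fun n => (Nat.one_div_pos_of_nat).ne'⟩
  have hlim' : Tendsto (fun n : ℕ => -(1 / ((n : ℝ) + 1))) atTop (𝓝[≠] 0) :=
    tendsto_nhdsWithin_iff.mpr ⟨by simpa using tendsto_one_div_add_atTop_nhds_zero_nat.neg (G := ℝ),
      Eventually.of_forall fun n => (neg_lt_zero.mpr Nat.one_div_pos_of_nat).ne⟩
  obtain ⟨S, hS, h1⟩ := exists_full_set_le_of_tendsto (Z := fun n : ℕ => X (t + 1 / ((n : ℝ) + 1)))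
    (c := fun n => (1 / ((n : ℝ) + 1))⁻¹) (fun n => by positivity) (fun n => hX _)
    (hslope.comp hlim)
  -- Backward increments carry a positive factor only towards −V, so −V is nondecreasing on level
  -- sets as well as V.
  obtain ⟨T, hT, h2⟩ := exists_full_set_le_of_tendsto
    (Z := fun n : ℕ => X (t + -(1 / ((n : ℝ) + 1)))) (Y := X t) (V := -V)
    (c := fun n => (1 / ((n : ℝ) + 1))⁻¹) (fun n => by positivity) (fun n => hX _) (by
      refine ((hslope.comp hlim').neg).congr fun n => ?_
      rw [Function.comp_apply, inv_neg, neg_smul, neg_neg])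
  refine ⟨S ∩ T ∩ {m | (-V : LagL2) m = -V m}, (hS.and hT).and (Lp.coeFn_neg V), ?_⟩
  rintro a ⟨⟨haS, haT⟩, ha : (-V : LagL2) a = -V a⟩ b ⟨⟨hbS, hbT⟩, hb : (-V : LagL2) b = -V b⟩ hab
  rcases le_total a b with hle | hle
  · have h3 := h1 a haS b hbS hle hab
    have h4 := h2 a haT b hbT hle hab
    rw [ha, hb] at h4
    linarith
  · have h3 := h1 b hbS a haS hle hab.symm
    have h4 := h2 b hbT a haT hle hab.symm
    rw [ha, hb] at h4
    linarith

/-- The primitive of `V` with respect to the reference measure. -/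
def refPrimitive (V : ℝ → ℝ) (s : ℝ) : ℝ := ∫ m in (0 : ℝ)..s, V m ∂refMeasure

/-- The Eulerian velocity at `x` of a monotone map of law `ρ` with Lagrangian velocity `V`:
the mean of `V` over the level set of `x`, or the value of `V` there if it is a point. -/
def levelVelocity (ρ : Measure ℝ) (V : ℝ → ℝ) (x : ℝ) : ℝ :=
  limsup (fun n : ℕ => (refPrimitive V (ρ.real (Iic x) + 1 / ((n : ℝ) + 1)) -
    refPrimitive V (ρ.real (Iio x) - 1 / ((n : ℝ) + 1))) /
      (ρ.real (Iic x) - ρ.real (Iio x) + 2 * (1 / ((n : ℝ) + 1)))) atTop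

theorem Lp.integrable_refMeasure (V : LagL2) : Integrable V refMeasure :=
  (Lp.memLp V).integrable one_le_two

theorem continuous_refPrimitive (V : LagL2) : Continuous (refPrimitive V) :=
  intervalIntegral.continuous_primitive
    (fun _ _ => (Lp.integrable_refMeasure V).intervalIntegrable) 0

theorem refPrimitive_sub (V : LagL2) (a b : ℝ) :
    refPrimitive V b - refPrimitive V a = ∫ m in a..b, V m ∂refMeasure :=
  intervalIntegral.integral_interval_sub_left
    (Lp.integrable_refMeasure V).intervalIntegrable (Lp.integrable_refMeasure V).intervalIntegrable

theorem ae_hasDerivAt_refPrimitive (V : LagL2) :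
    ∀ᵐ m ∂refMeasure, HasDerivAt (refPrimitive V) (V m) m := by
  have hint : Integrable ((Icc (0 : ℝ) 1).indicator V) volume :=
    (integrable_indicator_iff measurableSet_Icc).mpr (Lp.integrable_refMeasure V)
  have heq : refPrimitive V = fun s => ∫ m in (0 : ℝ)..s, (Icc (0 : ℝ) 1).indicator V m := by
    ext s
    simp only [refPrimitive, intervalIntegral, refMeasure]
    rw [Measure.restrict_restrict measurableSet_Ioc, Measure.restrict_restrict measurableSet_Ioc,
      setIntegral_indicator measurableSet_Icc, setIntegral_indicator measurableSet_Icc]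
  filter_upwards [ae_restrict_of_ae
      (_root_.LocallyIntegrable.ae_hasDerivAt_integral hint.locallyIntegrable),
    ae_restrict_mem measurableSet_Icc] with m hm hmI
  have := hm 0
  rwa [indicator_of_mem hmI, ← heq] at this

theorem tendsto_symm_quotient {W : ℝ → ℝ} {w m : ℝ} (h : HasDerivAt W w m) :
    Tendsto (fun n : ℕ => (W (m + 1 / ((n : ℝ) + 1)) - W (m - 1 / ((n : ℝ) + 1))) /
      (2 * (1 / ((n : ℝ) + 1)))) atTop (𝓝 w) := by
  have hslope := hasDerivAt_iff_tendsto_slope_zero.mp h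
  have hlim : Tendsto (fun n : ℕ => 1 / ((n : ℝ) + 1)) atTop (𝓝[≠] 0) :=
    tendsto_nhdsWithin_iff.mpr ⟨tendsto_one_div_add_atTop_nhds_zero_nat,
      Eventually.of_forall fun n => (Nat.one_div_pos_of_nat).ne'⟩
  have hlim' : Tendsto (fun n : ℕ => -(1 / ((n : ℝ) + 1))) atTop (𝓝[≠] 0) :=
    tendsto_nhdsWithin_iff.mpr ⟨by simpa using tendsto_one_div_add_atTop_nhds_zero_nat.neg (G := ℝ),
      Eventually.of_forall fun n => (neg_lt_zero.mpr Nat.one_div_pos_of_nat).ne⟩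
  have := ((hslope.comp hlim).add (hslope.comp hlim')).div_const 2
  rw [add_self_div_two] at this
  refine this.congr fun n => ?_
  have hn : (n : ℝ) + 1 ≠ 0 := by positivity
  simp only [Function.comp_apply, smul_eq_mul, ← sub_eq_add_neg]
  field_simp
  ring

/-- The point m lies between the masses a and b strictly below and up to X m. If a = b = m, the
formula is a symmetric difference quotient of the primitive at a Lebesgue point. If a < b, V equals
V m almost everywhere on (a, b], and the quotient tends to that mean. The padding 1/(n+1) lets one
formula cover both cases. -/
theorem levelVelocity_comp_ae_eq {X : ℝ → ℝ} {V : LagL2} (hX : AEMonotone X)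
    (hXm : AEMeasurable X refMeasure) (hV : ConstOnLevels X V) :
    ∀ᵐ m ∂refMeasure, levelVelocity (refMeasure.map X) V (X m) = V m := by
  obtain ⟨S, hS, hS', hSm⟩ := hX
  obtain ⟨T, hT, hTV⟩ := hV
  have := Measure.isProbabilityMeasure_map hXm
  filter_upwards [hS, hT, ae_hasDerivAt_refPrimitive V] with m hmS hmT hder
  have ha := measure_Iio_le_of_le hXm hS hS' hSm hmS le_rfl
  have hb := le_measure_Iic_of_le hXm hS hS' hSm hmS le_rfl
  rw [levelVelocity]
  set a := (refMeasure.map X).real (Iio (X m)) with ha_def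
  set b := (refMeasure.map X).real (Iic (X m)) with hb_def
  refine Tendsto.limsup_eq ?_
  rcases (ha.trans hb).eq_or_lt with hab | hab
  · have hma : m = a := le_antisymm (hab ▸ hb) ha
    rw [← hab, ← hma]
    simpa using tendsto_symm_quotient hder
  · have hb1 : b ≤ 1 := measureReal_le_one
    have ha0 : 0 ≤ a := measureReal_nonneg
    have hconst : ∀ᵐ y ∂refMeasure, y ∈ Ioc a b → V y = V m := by
      filter_upwards [hS, hT, Measure.ae_ne refMeasure b] with y hyS hyT hyb hy
      refine hTV y hyT m hmT ?_
      rcases lt_trichotomy (X y) (X m) with hlt | heq | hlt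
      · exact absurd (le_measure_Iio_of_lt hXm hS hS' hSm hyS hlt) (not_le.mpr hy.1)
      · exact heq
      · exact absurd (le_antisymm hy.2 (measure_Iic_le_of_lt hXm hS hS' hSm hyS hlt)) hyb
    have hsd : Ioc a b = Iic b \ Iic a := by
      ext y
      simp [and_comm]
    have hW : refPrimitive V b - refPrimitive V a = (b - a) * V m := by
      rw [refPrimitive_sub, intervalIntegral.integral_of_le hab.le,
        setIntegral_congr_ae measurableSet_Ioc hconst, setIntegral_const, smul_eq_mul,
        hsd, measureReal_sdiff (Iic_subset_Iic.mpr hab.le) measurableSet_Iic,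
        refMeasure_real_Iic ha0 (hab.le.trans hb1), refMeasure_real_Iic (ha0.trans hab.le) hb1]
    have hlim : Tendsto (fun n : ℕ => 1 / ((n : ℝ) + 1)) atTop (𝓝 0) :=
      tendsto_one_div_add_atTop_nhds_zero_nat
    have hc := continuous_refPrimitive V
    have h1 : Tendsto (fun ε : ℝ => (refPrimitive V (b + ε) - refPrimitive V (a - ε)) /
        (b - a + 2 * ε)) (𝓝 0) (𝓝 (V m)) := by
      have hne : b - a + 2 * 0 ≠ 0 := by linarith
      have : ContinuousAt (fun ε : ℝ => (refPrimitive V (b + ε) - refPrimitive V (a - ε)) /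
        (b - a + 2 * ε)) 0 := by
        refine ContinuousAt.div (Continuous.continuousAt (by fun_prop)) (by fun_prop) hne
      have h2 := this.tendsto
      simp only [add_zero, sub_zero, mul_zero, hW] at h2
      rwa [mul_div_cancel_left₀ _ (sub_pos.mpr hab).ne'] at h2
    exact h1.comp hlim

/-! ### Measurability in time -/

/-- A Carathéodory argument: the primitive is continuous in its endpoint, and for a fixed endpoint
it is an inner product of V with indicators. -/
theorem measurable_refPrimitive {V : ℝ → LagL2} (hV : StronglyMeasurable V) :
    Measurable fun p : ℝ × ℝ => refPrimitive (V p.1) p.2 := by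
  have h : Measurable (Function.uncurry fun (s t : ℝ) => refPrimitive (V t) s) := by
    refine measurable_uncurry_of_continuous_of_measurable
      (fun t => continuous_refPrimitive (V t)) fun s => ?_
    have hset (u : Set ℝ) (hu : MeasurableSet u) :
        Measurable fun t => ∫ m in u, V t m ∂refMeasure := by
      simp_rw [← L2.inner_indicatorConstLp_one (𝕜 := ℝ) hu (measure_ne_top refMeasure u)]
      exact (stronglyMeasurable_const.inner hV).measurable
    exact (hset _ measurableSet_Ioc).sub (hset _ measurableSet_Ioc)
  exact h.comp measurable_swap

theorem measurable_levelVelocity {ρ : ℝ → Measure ℝ} [∀ t, IsProbabilityMeasure (ρ t)]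
    (hρ : Measurable ρ) {V : ℝ → LagL2} (hV : StronglyMeasurable V) :
    Measurable fun p : ℝ × ℝ => levelVelocity (ρ p.1) (V p.1) p.2 := by
  let η : ProbabilityTheory.Kernel (ℝ × ℝ) ℝ := ⟨fun p => ρ p.1, hρ.comp measurable_fst⟩
  have : ProbabilityTheory.IsMarkovKernel η := ⟨fun p => inferInstanceAs
    (IsProbabilityMeasure (ρ p.1))⟩
  have ha : Measurable fun p : ℝ × ℝ => (ρ p.1).real (Iio p.2) :=
    (ProbabilityTheory.Kernel.measurable_kernel_prodMk_left (κ := η)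
      (t := {q : (ℝ × ℝ) × ℝ | q.2 < q.1.2})
      (measurableSet_lt measurable_snd measurable_fst.snd)).ennreal_toReal
  have hb : Measurable fun p : ℝ × ℝ => (ρ p.1).real (Iic p.2) :=
    (ProbabilityTheory.Kernel.measurable_kernel_prodMk_left (κ := η)
      (t := {q : (ℝ × ℝ) × ℝ | q.2 ≤ q.1.2})
      (measurableSet_le measurable_snd measurable_fst.snd)).ennreal_toReal
  have hW := measurable_refPrimitive hV
  refine Measurable.limsup fun n => ?_
  exact ((hW.comp (measurable_fst.prodMk (hb.add_const _))).sub
    (hW.comp (measurable_fst.prodMk (ha.sub_const _)))).div ((hb.sub ha).add_const _)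

theorem integral_abs_le_norm (Z : LagL2) : ∫ m, |Z m| ∂refMeasure ≤ ‖Z‖ := by
  have h1 := eLpNorm_le_eLpNorm_of_exponent_le (p := 1) (q := 2) one_le_two
    (Lp.aestronglyMeasurable Z)
  rw [eLpNorm_one_eq_lintegral_enorm] at h1
  rw [Lp.norm_def]
  refine le_trans (le_of_eq ?_) (ENNReal.toReal_mono (Lp.memLp Z).eLpNorm_ne_top h1)
  exact integral_norm_eq_lintegral_enorm (Lp.aestronglyMeasurable Z)

theorem continuous_integral_comp {X : ℝ → LagL2} (hX : Continuous X) {f : ℝ → ℝ} {K : ℝ≥0}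
    (hf : LipschitzWith K f) : Continuous fun t => ∫ m, f (X t m) ∂refMeasure := by
  have hint (t : ℝ) : Integrable (fun m => f (X t m)) refMeasure := by
    refine Integrable.mono' (g := fun m => |f 0| + K * |X t m|) (by
      exact (integrable_const _).add ((Lp.integrable_refMeasure (X t)).abs.const_mul _))
      (hf.continuous.comp_aestronglyMeasurable (Lp.aestronglyMeasurable _))
      (Eventually.of_forall fun m => ?_)
    have h1 := hf.dist_le_mul (X t m) 0
    rw [Real.dist_eq, Real.dist_eq, sub_zero] at h1
    have h2 := abs_add_le (f 0) (f (X t m) - f 0)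
    rw [add_sub_cancel] at h2
    rw [Real.norm_eq_abs]
    linarith
  have hdist (s t : ℝ) : dist (∫ m, f (X s m) ∂refMeasure) (∫ m, f (X t m) ∂refMeasure) ≤
      K * dist (X s) (X t) := by
    rw [dist_eq_norm, ← integral_sub (hint s) (hint t), dist_eq_norm]
    refine (norm_integral_le_integral_norm _).trans ?_
    refine le_trans ?_ (mul_le_mul_of_nonneg_left (integral_abs_le_norm (X s - X t)) K.2)
    rw [← integral_const_mul]
    refine integral_mono_ae ((hint s).sub (hint t)).norm
      ((Lp.integrable_refMeasure (X s - X t)).abs.const_mul _) ?_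
    filter_upwards [Lp.coeFn_sub (X s) (X t)] with m hm
    rw [hm, Pi.sub_apply]
    exact hf.dist_le_mul _ _
  refine continuous_iff_continuousAt.mpr fun t => tendsto_iff_dist_tendsto_zero.mpr ?_
  refine squeeze_zero (fun _ => dist_nonneg) (fun s => hdist s t) ?_
  have := (tendsto_iff_dist_tendsto_zero.mp (hX.tendsto t)).const_mul (K : ℝ)
  rwa [mul_zero] at this

/-- The indicator of (-∞, x] is the pointwise limit of Lipschitz cutoffs, whose integrals are
continuous in t, and these half-lines form a generating π-system. -/
theorem measurable_map_of_continuous {X : ℝ → LagL2} (hX : Continuous X) :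
    Measurable fun t => refMeasure.map (X t) := by
  have (t : ℝ) : IsProbabilityMeasure (refMeasure.map (X t)) :=
    Measure.isProbabilityMeasure_map (Lp.aemeasurable_refMeasure _)
  refine Measurable.measure_of_isPiSystem_of_isProbabilityMeasure
    (borel_eq_generateFrom_Iic ℝ ▸ BorelSpace.measurable_eq) isPiSystem_Iic ?_
  rintro _ ⟨x, rfl⟩
  let f : ℕ → ℝ → ℝ := fun n y => max 0 (min 1 (1 - n * (y - x)))
  have hf (n : ℕ) : LipschitzWith n (f n) := by
    refine LipschitzWith.const_max (LipschitzWith.const_min ?_ 1) 0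
    refine LipschitzWith.of_dist_le_mul fun y z => ?_
    rw [Real.dist_eq, Real.dist_eq, show (1 : ℝ) - n * (y - x) - (1 - n * (z - x)) =
      -(n * (y - z)) by ring, abs_neg, abs_mul, Nat.abs_cast]
    rfl
  have hlim (t : ℝ) : Tendsto (fun n => ∫ m, f n (X t m) ∂refMeasure) atTop
      (𝓝 ((refMeasure.map (X t)).real (Iic x))) := by
    have hae := Lp.aestronglyMeasurable (X t)
    rw [measureReal_def, Measure.map_apply_of_aemeasurable hae.aemeasurable measurableSet_Iic,
      ← measureReal_def, ← mul_one (refMeasure.real _), ← smul_eq_mul,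
      ← setIntegral_const (1 : ℝ), ← integral_indicator₀ (hae.aemeasurable.nullMeasurable measurableSet_Iic)]
    refine tendsto_integral_of_dominated_convergence (fun _ => 1)
      (fun n => (hf n).continuous.comp_aestronglyMeasurable hae) (integrable_const _)
      (fun n => Eventually.of_forall fun m => ?_) (Eventually.of_forall fun m => ?_)
    · rw [Real.norm_eq_abs, abs_of_nonneg (le_max_left _ _)]
      exact max_le zero_le_one (min_le_left _ _)
    · by_cases hm : X t m ≤ x
      · rw [indicator_of_mem (by exact hm)]
        refine tendsto_const_nhds.congr fun n => ?_
        have : (0 : ℝ) ≤ n * (x - X t m) := mul_nonneg n.cast_nonneg (by linarith)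
        have h2 : min 1 (1 - n * (X t m - x)) = 1 := min_eq_left (by linarith)
        simp only [f, h2]
        exact (max_eq_right zero_le_one).symm
      · rw [indicator_of_notMem (by exact hm)]
        push Not at hm
        obtain ⟨N, hN⟩ := exists_nat_gt (1 / (X t m - x))
        refine tendsto_const_nhds.congr' ?_
        filter_upwards [eventually_ge_atTop N] with n hn
        have h1 : 1 ≤ n * (X t m - x) := by
          have := (div_lt_iff₀ (sub_pos.mpr hm)).mp (hN.trans_le (Nat.cast_le.mpr hn))
          exact this.le
        exact (max_eq_left ((min_le_right _ _).trans (by linarith))).symm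
  have hreal : Measurable fun t => (refMeasure.map (X t)).real (Iic x) :=
    measurable_of_tendsto_metrizable
      (fun n => (continuous_integral_comp hX (hf n)).measurable) (tendsto_pi_nhds.mpr hlim)
  have heq : (fun t => refMeasure.map (X t) (Iic x)) =
      fun t => ENNReal.ofReal ((refMeasure.map (X t)).real (Iic x)) :=
    funext fun t => by rw [ofReal_measureReal]
  exact heq ▸ hreal.ennreal_ofReal

/-- If `W` is orthogonal to all smooth functions of `X`, it is orthogonal to all square-integrable
functions of `X`. -/
theorem integral_comp_mul_eq_zero {X W : LagL2}
    (h : ∀ φ : ℝ → ℝ, ContDiff ℝ ∞ φ → HasCompactSupport φ → ∫ m, φ (X m) * W m ∂refMeasure = 0)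
    {u : ℝ → ℝ} (hu : MemLp u 2 (refMeasure.map X)) : ∫ m, u (X m) * W m ∂refMeasure = 0 := by
  have hX : Measurable X := (Lp.stronglyMeasurable X).measurable
  have hmp : MeasurePreserving X refMeasure (refMeasure.map X) := ⟨hX, rfl⟩
  have : IsProbabilityMeasure (refMeasure.map X) := Measure.isProbabilityMeasure_map hX.aemeasurable
  let T : Lp ℝ 2 (refMeasure.map X) →L[ℝ] LagL2 :=
    (Lp.compMeasurePreservingₗᵢ ℝ X hmp).toContinuousLinearMap
  have hT {g : ℝ → ℝ} (hg : MemLp g 2 (refMeasure.map X)) :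
      inner ℝ W (T hg.toLp) = ∫ m, g (X m) * W m ∂refMeasure := by
    rw [L2.inner_def]
    refine integral_congr_ae ?_
    filter_upwards [Lp.coeFn_compMeasurePreserving hg.toLp hmp,
      hmp.quasiMeasurePreserving.ae_eq_comp hg.coeFn_toLp] with m h1 h2
    change inner ℝ (W m) ((Lp.compMeasurePreserving X hmp hg.toLp : LagL2) m) = _
    rw [h1, h2]
    rfl
  -- T is composition with X, so w is the conditional expectation of W given X, viewed on the target
  -- line. The hypothesis says that it vanishes as a distribution.
  set w := ContinuousLinearMap.adjoint T W with hw
  have hw0 : w = 0 := by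
    have hae : ∀ᵐ x ∂(refMeasure.map X), w x = 0 := by
      refine ae_eq_zero_of_integral_contDiff_smul_eq_zero
        ((Lp.memLp w).integrable one_le_two).locallyIntegrable fun g hg hgc => ?_
      have hgm : MemLp g 2 (refMeasure.map X) := hg.continuous.memLp_of_hasCompactSupport hgc
      rw [← h g hg hgc, ← hT hgm, ← ContinuousLinearMap.adjoint_inner_left, ← hw, L2.inner_def]
      refine integral_congr_ae ?_
      filter_upwards [hgm.coeFn_toLp] with x hx
      rw [hx]
      rfl
    exact (Lp.eq_zero_iff_ae_eq_zero).mpr hae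
  rw [← hT hu, ← ContinuousLinearMap.adjoint_inner_left, ← hw, hw0, inner_zero_left]

/-! ### Test functions along curves in L² -/

theorem memLp_test_comp {φ : ℝ × ℝ → ℝ} (hφ : Continuous φ) (hc : HasCompactSupport φ)
    (t : ℝ) (X : LagL2) : MemLp (fun m => φ (t, X m)) 2 refMeasure := by
  obtain ⟨C, hC⟩ := hφ.bounded_above_of_compact_support hc
  refine MemLp.of_bound ?_ C (Eventually.of_forall fun m => hC _)
  exact (hφ.comp (by fun_prop : Continuous fun x : ℝ => (t, x))).comp_aestronglyMeasurable
    (Lp.aestronglyMeasurable X)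

/-- The element `φ(t, X)` of `L²` for a test function `φ`. -/
def testComp {φ : ℝ × ℝ → ℝ} (hφ : Continuous φ) (hc : HasCompactSupport φ) (t : ℝ)
    (X : LagL2) : LagL2 := (memLp_test_comp hφ hc t X).toLp

theorem coeFn_testComp {φ : ℝ × ℝ → ℝ} (hφ : Continuous φ) (hc : HasCompactSupport φ) (t : ℝ)
    (X : LagL2) : testComp hφ hc t X =ᵐ[refMeasure] fun m => φ (t, X m) :=
  (memLp_test_comp hφ hc t X).coeFn_toLp

theorem norm_testComp_sub_le {φ : ℝ × ℝ → ℝ} (hφ : Continuous φ) (hc : HasCompactSupport φ)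
    {K : ℝ≥0} (hK : LipschitzWith K φ) (s t : ℝ) (X Y : LagL2) :
    ‖testComp hφ hc s X - testComp hφ hc t Y‖ ≤ K * |s - t| + K * ‖X - Y‖ := by
  have h1 : ‖testComp hφ hc s X - testComp hφ hc t X‖ ≤ K * |s - t| := by
    have := Lp.norm_le_of_ae_bound (f := testComp hφ hc s X - testComp hφ hc t X)
      (C := K * |s - t|) (by positivity) ?_
    · simpa [measureUnivNNReal] using this
    · filter_upwards [Lp.coeFn_sub (testComp hφ hc s X) (testComp hφ hc t X),
        coeFn_testComp hφ hc s X, coeFn_testComp hφ hc t X] with m hm h1 h2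
      rw [hm, Pi.sub_apply, h1, h2, ← dist_eq_norm]
      refine (hK.dist_le_mul _ _).trans (le_of_eq ?_)
      rw [Prod.dist_eq, dist_self, Real.dist_eq, max_eq_left (abs_nonneg _)]
  have h2 : ‖testComp hφ hc t X - testComp hφ hc t Y‖ ≤ K * ‖X - Y‖ := by
    refine Lp.norm_le_mul_norm_of_ae_le_mul ?_
    filter_upwards [Lp.coeFn_sub (testComp hφ hc t X) (testComp hφ hc t Y),
        coeFn_testComp hφ hc t X, coeFn_testComp hφ hc t Y, Lp.coeFn_sub X Y] with m hm h1 h2 h3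
    rw [hm, Pi.sub_apply, h1, h2, h3, Pi.sub_apply, ← dist_eq_norm, ← dist_eq_norm]
    refine (hK.dist_le_mul _ _).trans (le_of_eq ?_)
    rw [Prod.dist_eq, dist_self, max_eq_right dist_nonneg]
  calc _ = ‖(testComp hφ hc s X - testComp hφ hc t X) +
        (testComp hφ hc t X - testComp hφ hc t Y)‖ := by rw [sub_add_sub_cancel]
    _ ≤ _ := (norm_add_le _ _).trans (add_le_add h1 h2)

theorem norm_fderiv_apply_one_le {φ : ℝ × ℝ → ℝ} {K : ℝ≥0} (hK : LipschitzWith K φ)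
    (p : ℝ × ℝ) (v : ℝ) : |fderiv ℝ φ p (1, v)| ≤ K * (1 + |v|) := by
  refine ((fderiv ℝ φ p).le_opNorm (1, v)).trans ?_
  refine mul_le_mul (norm_fderiv_le_of_lipschitz ℝ hK) ?_ (norm_nonneg _) K.2
  rw [Prod.norm_def]
  refine max_le ?_ ?_
  · simp
  · simp

theorem memLp_one_add_abs (V : LagL2) (K : ℝ) :
    MemLp (fun m => K * (1 + |V m|)) 2 refMeasure := by
  have h : MemLp (fun m => 1 + |V m|) 2 refMeasure := (memLp_const (1 : ℝ)).add (Lp.memLp V).abs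
  exact h.const_mul K

theorem memLp_fderiv_test_comp {φ : ℝ × ℝ → ℝ} (hφ : ContDiff ℝ ∞ φ) (hc : HasCompactSupport φ)
    (t : ℝ) (X V : LagL2) :
    MemLp (fun m => fderiv ℝ φ (t, X m) (1, V m)) 2 refMeasure := by
  obtain ⟨K, hK⟩ := ContDiff.lipschitzWith_of_hasCompactSupport hc hφ (by simp)
  have hcont' : Continuous fun q : ℝ × ℝ => fderiv ℝ φ (t, q.1) :=
    (hφ.continuous_fderiv (by simp)).comp (by fun_prop : Continuous fun q : ℝ × ℝ => (t, q.1))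
  have hcont : Continuous fun q : ℝ × ℝ => fderiv ℝ φ (t, q.1) (1, q.2) :=
    hcont'.clm_apply (by fun_prop)
  have hmeas : AEStronglyMeasurable (fun m => fderiv ℝ φ (t, X m) (1, V m)) refMeasure := by
    have := hcont.comp_aestronglyMeasurable
      ((Lp.aestronglyMeasurable X).prodMk (Lp.aestronglyMeasurable V))
    exact this
  refine (memLp_one_add_abs V K).mono hmeas (Eventually.of_forall fun m => ?_)
  rw [Real.norm_eq_abs]
  exact (norm_fderiv_apply_one_le hK _ _).trans (le_abs_self _)

/-- Dominated convergence for the squares. The explicit G is needed because almost everywhere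
representatives of E, chosen separately for uncountably many i, need not converge pointwise. -/
theorem tendsto_zero_of_dominated_Lp {ι : Type*} {l : Filter ι} [l.IsCountablyGenerated]
    {E : ι → LagL2} {B : ℝ → ℝ} (hB : MemLp B 2 refMeasure)
    (hEB : ∀ᶠ i in l, ∀ᵐ m ∂refMeasure, |E i m| ≤ B m)
    {G : ι → ℝ → ℝ} (hG : ∀ i, E i =ᵐ[refMeasure] G i)
    (hlim : ∀ᵐ m ∂refMeasure, Tendsto (fun i => G i m) l (𝓝 0)) :
    Tendsto E l (𝓝 0) := by
  have hsq (i : ι) : ‖E i‖ ^ 2 = ∫ m, G i m ^ 2 ∂refMeasure := by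
    rw [← real_inner_self_eq_norm_sq, L2.inner_def]
    refine integral_congr_ae ?_
    filter_upwards [hG i] with m hm
    rw [hm, real_inner_self_eq_norm_sq, Real.norm_eq_abs, sq_abs]
  have h0 : Tendsto (fun i => ‖E i‖ ^ 2) l (𝓝 0) := by
    simp_rw [hsq]
    have := tendsto_integral_filter_of_dominated_convergence (μ := refMeasure) (l := l)
      (F := fun i m => G i m ^ 2) (f := fun _ => 0) (fun m => B m ^ 2) ?_ ?_ hB.integrable_sq ?_
    · simpa using this
    · exact Eventually.of_forall fun i =>
        ((Lp.aestronglyMeasurable (E i)).congr (hG i)).pow 2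
    · filter_upwards [hEB] with i hi
      filter_upwards [hi, hG i] with m h1 h2
      rw [h2] at h1
      rw [Real.norm_eq_abs, abs_pow]
      gcongr
    · filter_upwards [hlim] with m hm
      simpa using hm.pow 2
  rw [tendsto_zero_iff_norm_tendsto_zero]
  have := h0.sqrt
  simpa [Real.sqrt_sq] using this

/-- Chain rule in `L²`. -/
theorem HasDerivAt.testComp {φ : ℝ × ℝ → ℝ} (hφ : ContDiff ℝ ∞ φ) (hc : HasCompactSupport φ)
    {X : ℝ → LagL2} {V : LagL2} {t : ℝ} (hX : HasDerivAt X V t) :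
    HasDerivAt (fun s => testComp hφ.continuous hc s (X s))
      (memLp_fderiv_test_comp hφ hc t (X t) V).toLp t := by
  obtain ⟨K, hK⟩ := ContDiff.lipschitzWith_of_hasCompactSupport hc hφ (by simp)
  set D : LagL2 := (memLp_fderiv_test_comp hφ hc t (X t) V).toLp with hD
  have hDcoe := (memLp_fderiv_test_comp hφ hc t (X t) V).coeFn_toLp
  set Θ : ℝ → LagL2 → LagL2 := _root_.testComp hφ.continuous hc
  have hΘ (s : ℝ) (Y : LagL2) := coeFn_testComp hφ.continuous hc s Y
  rw [hasDerivAt_iff_tendsto_slope_zero] at hX ⊢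
  -- Replacing the curve by its tangent line costs o(h), by the Lipschitz bound. On the tangent
  -- line, `h2` is the pointwise chain rule, dominated by a multiple of 1 + |V|.
  have h1 : Tendsto (fun h : ℝ => h⁻¹ • (Θ (t + h) (X (t + h)) - Θ (t + h) (X t + h • V)))
      (𝓝[≠] 0) (𝓝 0) := by
    have hX0 : Tendsto (fun h : ℝ => K * ‖h⁻¹ • (X (t + h) - X t) - V‖) (𝓝[≠] 0) (𝓝 0) := by
      have := (tendsto_iff_norm_sub_tendsto_zero.mp hX).const_mul (K : ℝ)
      rwa [mul_zero] at this
    refine squeeze_zero_norm' ?_ hX0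
    filter_upwards [self_mem_nhdsWithin] with h hh
    have hne : h ≠ 0 := hh
    have hrw : h⁻¹ • (X (t + h) - X t) - V = h⁻¹ • (X (t + h) - (X t + h • V)) := by
      rw [← sub_sub, smul_sub h⁻¹ (X (t + h) - X t), smul_smul, inv_mul_cancel₀ hne, one_smul]
    rw [hrw, norm_smul, norm_smul]
    have := norm_testComp_sub_le hφ.continuous hc hK (t + h) (t + h) (X (t + h)) (X t + h • V)
    rw [sub_self, abs_zero, mul_zero, zero_add] at this
    calc _ ≤ ‖h⁻¹‖ * (K * ‖X (t + h) - (X t + h • V)‖) := by gcongr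
      _ = _ := by ring
  have h2 : Tendsto (fun h : ℝ => h⁻¹ • (Θ (t + h) (X t + h • V) - Θ t (X t)) - D)
      (𝓝[≠] 0) (𝓝 0) := by
    have hcoe (h : ℝ) : ∀ᵐ m ∂refMeasure,
        (h⁻¹ • (Θ (t + h) (X t + h • V) - Θ t (X t)) - D : LagL2) m =
        h⁻¹ * (φ (t + h, X t m + h * V m) - φ (t, X t m)) -
          fderiv ℝ φ (t, X t m) (1, V m) := by
      filter_upwards [Lp.coeFn_sub (h⁻¹ • (Θ (t + h) (X t + h • V) - Θ t (X t))) D, hDcoe,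
        Lp.coeFn_smul h⁻¹ (Θ (t + h) (X t + h • V) - Θ t (X t)),
        Lp.coeFn_sub (Θ (t + h) (X t + h • V)) (Θ t (X t)), hΘ (t + h) (X t + h • V),
        hΘ t (X t), Lp.coeFn_add (X t) (h • V), Lp.coeFn_smul h V] with m e1 e2 e3 e4 e5 e6 e7 e8
      rw [e1, Pi.sub_apply, e2, e3, Pi.smul_apply, e4, Pi.sub_apply, e5, e6, e7, Pi.add_apply, e8,
        Pi.smul_apply, smul_eq_mul, smul_eq_mul]
    refine tendsto_zero_of_dominated_Lp (B := fun m => 2 * (K * (1 + |V m|))) ?_ ?_ hcoe ?_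
    · exact (memLp_one_add_abs V K).const_mul 2
    · filter_upwards [self_mem_nhdsWithin] with h hh
      have hne : h ≠ 0 := hh
      filter_upwards [hcoe h] with m hm
      rw [hm, two_mul]
      refine (abs_sub _ _).trans (add_le_add ?_ (norm_fderiv_apply_one_le hK _ _))
      rw [abs_mul, abs_inv, inv_mul_le_iff₀ (abs_pos.mpr hne)]
      refine (hK.dist_le_mul (t + h, X t m + h * V m) (t, X t m)).trans ?_
      rw [Prod.dist_eq, Real.dist_eq, Real.dist_eq, add_sub_cancel_left, add_sub_cancel_left,
        abs_mul, mul_left_comm]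
      refine mul_le_mul_of_nonneg_left (max_le ?_ ?_) K.2
      · nlinarith [abs_nonneg h, abs_nonneg (V m), mul_nonneg (abs_nonneg h) (abs_nonneg (V m))]
      · nlinarith [abs_nonneg h]
    · refine Eventually.of_forall fun m => ?_
      have hline : HasDerivAt (fun h : ℝ => (t + h, X t m + h * V m)) (1, V m) 0 := by
        refine ((hasDerivAt_id (0 : ℝ)).const_add t).prodMk ?_
        simpa using ((hasDerivAt_id (0 : ℝ)).mul_const (V m)).const_add (X t m)
      have hd : HasFDerivAt φ (fderiv ℝ φ (t, X t m)) (t + 0, X t m + 0 * V m) := by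
        rw [add_zero, zero_mul, add_zero]
        exact (hφ.differentiable (by simp) _).hasFDerivAt
      have := hasDerivAt_iff_tendsto_slope_zero.mp (hd.comp_hasDerivAt 0 hline)
      simpa [sub_eq_zero] using tendsto_sub_nhds_zero_iff.mpr this
  have h3 := (h1.add h2).add_const D
  rw [add_zero, zero_add] at h3
  refine h3.congr fun h => ?_
  rw [← add_sub_assoc, sub_add_cancel, ← smul_add, sub_add_sub_cancel]

/-! ### The Eulerian force and the Poisson potential -/

/-- `1_{b < a} + 1_{b ≤ a}`. -/
def ltAddLe (a b : ℝ) : ℝ := (Iio a).indicator 1 b + (Iic a).indicator 1 b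

theorem ltAddLe_of_lt {a b : ℝ} (h : b < a) : ltAddLe a b = 2 := by
  simp only [ltAddLe, indicator, mem_Iio, mem_Iic, h, h.le, Pi.one_apply, if_true]; norm_num

theorem ltAddLe_of_gt {a b : ℝ} (h : a < b) : ltAddLe a b = 0 := by
  simp [ltAddLe, indicator, h.not_gt, h.not_ge]

theorem ltAddLe_self (a : ℝ) : ltAddLe a a = 1 := by
  simp [ltAddLe, indicator]

theorem abs_ltAddLe_le (a b : ℝ) : |ltAddLe a b| ≤ 2 := by
  rcases lt_trichotomy a b with h | rfl | h
  · rw [ltAddLe_of_gt h]; norm_num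
  · rw [ltAddLe_self]; norm_num
  · rw [ltAddLe_of_lt h]; norm_num

theorem measurable_ltAddLe : Measurable fun p : ℝ × ℝ => ltAddLe p.1 p.2 := by
  have h1 : MeasurableSet {p : ℝ × ℝ | p.2 < p.1} := measurableSet_lt measurable_snd measurable_fst
  have h2 : MeasurableSet {p : ℝ × ℝ | p.2 ≤ p.1} := measurableSet_le measurable_snd measurable_fst
  exact (measurable_const.indicator h1).add (measurable_const.indicator h2)

theorem integral_ltAddLe_comp {X : ℝ → ℝ} (hX : Measurable X) (a : ℝ) :
    ∫ m, ltAddLe a (X m) ∂refMeasure =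
      (refMeasure.map X).real (Iio a) + (refMeasure.map X).real (Iic a) := by
  have := Measure.isProbabilityMeasure_map (μ := refMeasure) hX.aemeasurable
  rw [← integral_map (f := ltAddLe a) hX.aemeasurable
    (measurable_ltAddLe.comp measurable_prodMk_left).aestronglyMeasurable]
  have h1 : Integrable ((Iio a).indicator (1 : ℝ → ℝ)) (refMeasure.map X) :=
    (integrable_const (1 : ℝ)).indicator measurableSet_Iio
  have h2 : Integrable ((Iic a).indicator (1 : ℝ → ℝ)) (refMeasure.map X) :=
    (integrable_const (1 : ℝ)).indicator measurableSet_Iic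
  simp only [ltAddLe]
  rw [integral_add h1 h2, integral_indicator_one measurableSet_Iio,
    integral_indicator_one measurableSet_Iic]

theorem ae_prod_ne : ∀ᵐ p ∂(refMeasure.prod refMeasure), p.1 ≠ p.2 := by
  have hs : MeasurableSet {p : ℝ × ℝ | p.1 ≠ p.2} :=
    (measurableSet_eq_fun measurable_fst measurable_snd).compl
  rw [Measure.ae_prod_iff_ae_ae hs]
  exact Eventually.of_forall fun x => (Measure.ae_ne refMeasure x).mono fun y hy => hy.symm

/-- The level means of the identity are the means of the left and right limits of the
distribution function of a monotone map. -/
theorem integral_mul_level_mean {X : ℝ → ℝ} (hX : AEMonotone X) (hXm : Measurable X)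
    {g : ℝ → ℝ} (hg : Measurable g) {C : ℝ} (hC : ∀ x, |g x| ≤ C) :
    ∫ m, g (X m) * ((refMeasure.map X).real (Iio (X m)) +
      (refMeasure.map X).real (Iic (X m)) - 2 * m) ∂refMeasure = 0 := by
  obtain ⟨S, hS, hS', hm⟩ := hX
  -- X can change the order of two points only by creating a tie. There the bracket is +1 one way
  -- and −1 the other, with equal values of g, so G is antisymmetric almost everywhere. Integrating
  -- out the second variable produces the level mean minus 2m.
  let G : ℝ × ℝ → ℝ := fun p => g (X p.1) * (ltAddLe (X p.1) (X p.2) - ltAddLe p.1 p.2)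
  have hGm : Measurable G := (hg.comp (hXm.comp measurable_fst)).mul
    ((measurable_ltAddLe.comp ((hXm.comp measurable_fst).prodMk (hXm.comp measurable_snd))).sub
      measurable_ltAddLe)
  have hG : Integrable G (refMeasure.prod refMeasure) := by
    refine Integrable.of_bound hGm.aestronglyMeasurable (C * 4) (Eventually.of_forall fun p => ?_)
    rw [Real.norm_eq_abs, abs_mul]
    refine mul_le_mul (hC _) ((abs_sub _ _).trans ?_) (abs_nonneg _)
      ((abs_nonneg _).trans (hC 0))
    linarith [abs_ltAddLe_le (X p.1) (X p.2), abs_ltAddLe_le p.1 p.2]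
  have hzero : ∫ p, G p ∂(refMeasure.prod refMeasure) = 0 := by
    have hsum : ∫ p, (G p + G p.swap) ∂(refMeasure.prod refMeasure) = 0 := by
      refine integral_eq_zero_of_ae ?_
      filter_upwards [Measure.quasiMeasurePreserving_fst.ae hS,
        Measure.quasiMeasurePreserving_snd.ae hS, ae_prod_ne] with p h1 h2 hne
      simp only [G, Prod.fst_swap, Prod.snd_swap, Pi.zero_apply]
      have key {a b : ℝ} (ha : a ∈ S) (hb : b ∈ S) (hab : a < b) :
          g (X a) * (ltAddLe (X a) (X b) - ltAddLe a b) +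
          g (X b) * (ltAddLe (X b) (X a) - ltAddLe b a) = 0 := by
        rw [ltAddLe_of_gt hab, ltAddLe_of_lt hab]
        rcases (hm ha hb hab.le).eq_or_lt with heq | hlt
        · rw [heq, ltAddLe_self]; ring
        · rw [ltAddLe_of_gt hlt, ltAddLe_of_lt hlt]; ring
      rcases lt_or_gt_of_ne hne with h | h
      · exact key h1 h2 h
      · rw [add_comm]; exact key h2 h1 h
    have hsw : ∫ p, G p.swap ∂(refMeasure.prod refMeasure) =
        ∫ p, G p ∂(refMeasure.prod refMeasure) := integral_prod_swap G
    have hGs : Integrable (fun p => G p.swap) (refMeasure.prod refMeasure) := hG.swap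
    rw [integral_add hG hGs, hsw] at hsum
    linarith
  rw [integral_prod _ hG] at hzero
  rw [← hzero]
  refine integral_congr_ae ?_
  filter_upwards [ae_refMeasure_mem_Ioo] with m hmI
  have hb (a : ℝ) {Z : ℝ → ℝ} (hZ : Measurable Z) :
      Integrable (fun y => ltAddLe a (Z y)) refMeasure :=
    Integrable.of_bound ((measurable_ltAddLe.comp
      (measurable_const.prodMk hZ)).aestronglyMeasurable) 2
      (Eventually.of_forall fun y => abs_ltAddLe_le _ _)
  simp only [G]
  rw [integral_const_mul, integral_sub (hb _ hXm) (hb _ measurable_id'),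
    integral_ltAddLe_comp hXm, integral_ltAddLe_comp measurable_id', Measure.map_id',
    refMeasure_real_Iio hmI.1.le hmI.2.le, refMeasure_real_Iic hmI.1.le hmI.2.le, two_mul]

theorem integral_mul_forceDensity (κ : ℝ) {X : ℝ → ℝ} (hX : AEMonotone X) (hXm : Measurable X)
    {g : ℝ → ℝ} (hg : Measurable g) {C : ℝ} (hC : ∀ x, |g x| ≤ C) :
    ∫ x, g x * forceDensity κ (refMeasure.map X) x ∂(refMeasure.map X) =
      ∫ m, g (X m) * -(κ * (2 * m - 1) / 2) ∂refMeasure := by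
  have := Measure.isProbabilityMeasure_map (μ := refMeasure) hXm.aemeasurable
  have h0 := integral_mul_level_mean hX hXm hg hC
  set ρ := refMeasure.map X
  have hmIio : Measurable fun x => ρ.real (Iio x) :=
    Monotone.measurable fun a b hab => measureReal_mono (Iio_subset_Iio hab)
  have hmIic : Measurable fun x => ρ.real (Iic x) :=
    Monotone.measurable fun a b hab => measureReal_mono (Iic_subset_Iic.mpr hab)
  have hfm : Measurable (forceDensity κ ρ) :=
    ((hmIio.add hmIic).sub_const 1).const_mul (-(κ / 2))
  have hbd : ∀ᵐ m ∂refMeasure, ‖g (X m) * -(κ * (2 * m - 1) / 2)‖ ≤ C * |κ| := by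
    filter_upwards [ae_refMeasure_mem_Ioo] with m hm
    rw [norm_mul, norm_neg, Real.norm_eq_abs, Real.norm_eq_abs, abs_div, abs_mul, abs_two]
    have : |2 * m - 1| ≤ 1 := abs_le.mpr ⟨by linarith [hm.1], by linarith [hm.2]⟩
    refine mul_le_mul (hC _) ?_ (by positivity) ((abs_nonneg _).trans (hC 0))
    nlinarith [abs_nonneg κ]
  have hi1 : Integrable (fun m => g (X m) * -(κ * (2 * m - 1) / 2)) refMeasure :=
    Integrable.of_bound (by
      exact ((hg.comp hXm).mul (by fun_prop)).aestronglyMeasurable) _ hbd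
  have hfb (x : ℝ) : |forceDensity κ ρ x| ≤ |κ| := by
    have h1 : ρ.real (Iio x) ≤ 1 := measureReal_le_one
    have h2 : ρ.real (Iic x) ≤ 1 := measureReal_le_one
    have h3 : 0 ≤ ρ.real (Iio x) := measureReal_nonneg
    have h4 : 0 ≤ ρ.real (Iic x) := measureReal_nonneg
    rw [forceDensity, abs_mul, abs_neg, abs_div, abs_two]
    have : |ρ.real (Iio x) + ρ.real (Iic x) - 1| ≤ 1 :=
      abs_le.mpr ⟨by linarith, by linarith⟩
    nlinarith [abs_nonneg κ]
  have hi2 : Integrable (fun m => g (X m) * forceDensity κ ρ (X m)) refMeasure :=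
    Integrable.of_bound ((hg.comp hXm).mul (hfm.comp hXm)).aestronglyMeasurable (C * |κ|)
      (Eventually.of_forall fun m => by
        rw [norm_mul]
        exact mul_le_mul (hC _) (hfb _) (abs_nonneg _) ((abs_nonneg _).trans (hC 0)))
  have hgf : Measurable fun x => g x * forceDensity κ ρ x := hg.mul hfm
  rw [integral_map hXm.aemeasurable hgf.aestronglyMeasurable, ← sub_eq_zero,
    ← integral_sub hi2 hi1, ← mul_zero (-(κ / 2)), ← h0, ← integral_const_mul]
  refine integral_congr_ae (Eventually.of_forall fun m => ?_)
  simp only [forceDensity]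
  ring

/-- This is |x − y|'' = 2δ_y: on either side of y the function (x − y)φ' − φ is a primitive, and
each half-line contributes φ(y). -/
theorem integral_abs_sub_mul_deriv_deriv {φ : ℝ → ℝ} (hφ : ContDiff ℝ ∞ φ)
    (hc : HasCompactSupport φ) (y : ℝ) : ∫ x, |x - y| * deriv (deriv φ) x = 2 * φ y := by
  have hφ' : ContDiff ℝ ∞ (deriv φ) := (contDiff_infty_iff_deriv.mp hφ).2
  have hφ'' : ContDiff ℝ ∞ (deriv (deriv φ)) := (contDiff_infty_iff_deriv.mp hφ').2
  let F : ℝ → ℝ := fun x => (x - y) * deriv φ x - φ x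
  have hF (x : ℝ) : HasDerivAt F ((x - y) * deriv (deriv φ) x) x := by
    have h1 := ((hasDerivAt_id x).sub_const y).mul (hφ'.differentiable (by simp) x).hasDerivAt
    have h2 := h1.sub (hφ.differentiable (by simp) x).hasDerivAt
    convert! h2 using 1
    simp
  have hFc : HasCompactSupport F := (hc.deriv.mul_left (f := fun x => x - y)).sub hc
  have hFcont : Continuous F := ((continuous_id.sub continuous_const).mul hφ'.continuous).sub
    hφ.continuous
  have hF0 : Tendsto F (cocompact ℝ) (𝓝 0) := hFc.is_zero_at_infty
  have hint : Integrable fun x => (x - y) * deriv (deriv φ) x :=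
    Continuous.integrable_of_hasCompactSupport
      ((continuous_id.sub continuous_const).mul hφ''.continuous) hc.deriv.deriv.mul_left
  have hint' : Integrable fun x => |x - y| * deriv (deriv φ) x :=
    Continuous.integrable_of_hasCompactSupport
      ((continuous_id.sub continuous_const).abs.mul hφ''.continuous) hc.deriv.deriv.mul_left
  have h1 : ∫ x in Ioi y, |x - y| * deriv (deriv φ) x = φ y := by
    rw [setIntegral_congr_fun measurableSet_Ioi (g := fun x => (x - y) * deriv (deriv φ) x)
      fun x hx => by simp only [abs_of_pos (sub_pos.mpr (mem_Ioi.mp hx))],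
      integral_Ioi_of_hasDerivAt_of_tendsto' (fun x _ => hF x) hint.integrableOn
        (hF0.mono_left atTop_le_cocompact)]
    simp [F]
  have h2 : ∫ x in Iic y, |x - y| * deriv (deriv φ) x = φ y := by
    rw [setIntegral_congr_fun measurableSet_Iic (g := fun x => -((x - y) * deriv (deriv φ) x))
      fun x hx => by simp only [abs_of_nonpos (sub_nonpos.mpr (mem_Iic.mp hx)), neg_mul],
      integral_neg, integral_Iic_of_hasDerivAt_of_tendsto' (fun x _ => hF x) hint.integrableOn
        (hF0.mono_left atBot_le_cocompact)]
    simp [F]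
  rw [← integral_add_compl measurableSet_Ioi hint', compl_Ioi, h1, h2, two_mul]

/-- The potential is (κ/2) ∫ |x − y| ρ(dy), and Fubini reduces the equation to a single y. The
symmetric quotients of |x − y| are bounded by 1 and tend to the sign of x − y, with value 0 at y =
x; hence an atom counts half on each side. -/
theorem isPoissonForce_of_isP2 (κ : ℝ) {ρ : Measure ℝ} (hρ : IsP2 ρ) : IsPoissonForce κ ρ := by
  have := hρ.1
  have hid : Integrable (fun y : ℝ => y) ρ := hρ.2.integrable one_le_two
  have hint (x : ℝ) : Integrable (fun y => |x - y|) ρ := ((integrable_const x).sub hid).abs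
  refine ⟨fun x => κ / 2 * ∫ y, |x - y| ∂ρ, ⟨?_, ?_⟩, ?_⟩
  · have hlip : LipschitzWith 1 fun x => ∫ y, |x - y| ∂ρ := by
      refine LipschitzWith.of_dist_le_mul fun x x' => ?_
      rw [dist_eq_norm, ← integral_sub (hint x) (hint x')]
      refine (norm_integral_le_of_norm_le_const (C := |x - x'|)
        (Eventually.of_forall fun y => ?_)).trans (le_of_eq ?_)
      · refine (abs_abs_sub_abs_le _ _).trans (le_of_eq ?_)
        rw [sub_sub_sub_cancel_right]
      · simp [Real.dist_eq]
    exact continuous_const.mul hlip.continuous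
  · intro φ hφ hc
    have hφ' : ContDiff ℝ ∞ (deriv φ) := (contDiff_infty_iff_deriv.mp hφ).2
    have hφ'' : ContDiff ℝ ∞ (deriv (deriv φ)) := (contDiff_infty_iff_deriv.mp hφ').2
    have hcc := hc.deriv.deriv
    have hI1 : Integrable fun x : ℝ => |x| * |deriv (deriv φ) x| :=
      Continuous.integrable_of_hasCompactSupport
        (continuous_abs.mul hφ''.continuous.abs) hcc.norm.mul_left
    have hI2 : Integrable fun x : ℝ => |deriv (deriv φ) x| :=
      Continuous.integrable_of_hasCompactSupport hφ''.continuous.abs hcc.norm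
    have hprod : Integrable (fun p : ℝ × ℝ => |p.1 - p.2| * deriv (deriv φ) p.1)
        (volume.prod ρ) := by
      refine ((hI1.mul_prod (integrable_const (1 : ℝ))).add (hI2.mul_prod hid.abs)).mono' ?_ ?_
      · exact ((continuous_fst.sub continuous_snd).abs.mul
          (hφ''.continuous.comp continuous_fst)).aestronglyMeasurable
      · refine Eventually.of_forall fun p => ?_
        rw [norm_mul, Real.norm_eq_abs, Real.norm_eq_abs, abs_abs]
        have := abs_sub p.1 p.2
        simp only [Pi.add_apply]
        nlinarith [abs_nonneg (deriv (deriv φ) p.1)]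
    have hswap := integral_integral_swap (f := fun x y => |x - y| * deriv (deriv φ) x) hprod
    simp_rw [integral_abs_sub_mul_deriv_deriv hφ hc, integral_mul_const] at hswap
    simp_rw [mul_assoc, integral_const_mul]
    rw [hswap, integral_const_mul]
    ring
  · intro x
    let s : ℝ → ℝ := fun y => (Iio x).indicator 1 y - (Ioi x).indicator 1 y
    have hs : ∫ y, s y ∂ρ = ρ.real (Iio x) + ρ.real (Iic x) - 1 := by
      have h1 : ρ.real (Ioi x) = 1 - ρ.real (Iic x) := by
        rw [← compl_Iic, probReal_compl_eq_one_sub measurableSet_Iic]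
      have h2 : Integrable ((Iio x).indicator (1 : ℝ → ℝ)) ρ :=
        (integrable_const (1 : ℝ)).indicator measurableSet_Iio
      have h3 : Integrable ((Ioi x).indicator (1 : ℝ → ℝ)) ρ :=
        (integrable_const (1 : ℝ)).indicator measurableSet_Ioi
      rw [integral_sub h2 h3, integral_indicator_one measurableSet_Iio,
        integral_indicator_one measurableSet_Ioi, h1]
      ring
    have hlim : Tendsto (fun h : ℝ => ∫ y, (|x + h - y| - |x - h - y|) / (2 * h) ∂ρ) (𝓝[>] 0)
        (𝓝 (∫ y, s y ∂ρ)) := by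
      refine tendsto_integral_filter_of_dominated_convergence (fun _ => 1)
        (Eventually.of_forall fun h => ?_) ?_ (integrable_const _)
        (Eventually.of_forall fun y => ?_)
      · exact (((hint _).sub (hint _)).div_const _).aestronglyMeasurable
      · filter_upwards [self_mem_nhdsWithin] with h hh
        have hpos : 0 < h := hh
        refine Eventually.of_forall fun y => ?_
        rw [Real.norm_eq_abs, abs_div, div_le_one (by positivity)]
        refine (abs_abs_sub_abs_le _ _).trans (le_of_eq ?_)
        congr 1
        ring
      · rcases lt_trichotomy y x with hy | rfl | hy
        · have hsy : s y = 1 := by simp [s, hy, hy.not_gt]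
          rw [hsy]
          refine tendsto_const_nhds.congr' ?_
          filter_upwards [Ioo_mem_nhdsGT (sub_pos.mpr hy)] with h hh
          rw [abs_of_pos (by linarith [hh.1]), abs_of_pos (by linarith [hh.2]), eq_div_iff
            (by linarith [hh.1])]
          ring
        · have hsy : s y = 0 := by simp [s]
          rw [hsy]
          refine tendsto_const_nhds.congr fun h => ?_
          rw [add_sub_cancel_left, sub_sub_cancel_left, abs_neg, sub_self, zero_div]
        · have hsy : s y = -1 := by simp [s, hy, hy.not_gt]
          rw [hsy]
          refine tendsto_const_nhds.congr' ?_
          filter_upwards [Ioo_mem_nhdsGT (sub_pos.mpr hy)] with h hh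
          rw [abs_of_neg (by linarith [hh.2]), abs_of_neg (by linarith [hh.1]), eq_div_iff
            (by linarith [hh.1])]
          ring
    have hfin := hlim.const_mul (κ / 2)
    rw [hs] at hfin
    have hf : -forceDensity κ ρ x = κ / 2 * (ρ.real (Iio x) + ρ.real (Iic x) - 1) := by
      rw [forceDensity]; ring
    rw [hf]
    refine hfin.congr fun h => ?_
    rw [integral_div, integral_sub (hint _) (hint _)]
    ring

/-! ### The projected flow -/

/-- The free motion with constant force, whose projection onto the cone is the Lagrangian flow. -/
def freePath (κ : ℝ) (X₀ V₀ : LagL2) (t : ℝ) : LagL2 :=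
  X₀ + (t • V₀ + (t ^ 2 / 2) • lagrangianForce κ 0)

theorem modifiedVelocity_eq (κ : ℝ) (V₀ : LagL2) (X : ℝ → LagL2) (t : ℝ) :
    modifiedVelocity κ V₀ X t = V₀ + t • lagrangianForce κ 0 := by
  change V₀ + ∫ _ in (0 : ℝ)..t, lagrangianForce κ 0 = _
  rw [intervalIntegral.integral_const, sub_zero]

/-- The time integrals no longer involve X, so existence, uniqueness and Lipschitz bounds all reduce
to a projection at each separate time. -/
theorem isProjectedFlow_iff {κ : ℝ} {X₀ V₀ : LagL2} {X : ℝ → LagL2} :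
    IsProjectedFlow κ X₀ V₀ X ↔
      ∀ t, IsMetricProjection monotoneCone (freePath κ X₀ V₀ t) (X t) := by
  refine forall_congr' fun t => ?_
  have : ∫ s in (0 : ℝ)..t, modifiedVelocity κ V₀ X s =
      t • V₀ + (t ^ 2 / 2) • lagrangianForce κ 0 := by
    simp_rw [modifiedVelocity_eq]
    rw [intervalIntegral.integral_add (by simp)
      ((Continuous.intervalIntegrable (by fun_prop)) _ _), intervalIntegral.integral_const,
      intervalIntegral.integral_smul_const, integral_id]
    simp
  rw [this, freePath]

theorem hasDerivAt_freePath (κ : ℝ) (X₀ V₀ : LagL2) (t : ℝ) :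
    HasDerivAt (freePath κ X₀ V₀) (V₀ + t • lagrangianForce κ 0) t := by
  have h1 : HasDerivAt (fun s : ℝ => s • V₀) V₀ t := by
    simpa using (hasDerivAt_id t).smul_const V₀
  have h2 : HasDerivAt (fun s : ℝ => (s ^ 2 / 2) • lagrangianForce κ 0)
      (t • lagrangianForce κ 0) t := by
    have : HasDerivAt (fun s : ℝ => s ^ 2 / 2) t t := by
      simpa using ((hasDerivAt_id t).pow 2).div_const 2
    exact this.smul_const _
  exact (h1.add h2).const_add X₀

theorem lipschitzOnWith_freePath (κ : ℝ) (X₀ V₀ : LagL2) (n : ℕ) :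
    LipschitzOnWith (‖V₀‖₊ + n * ‖lagrangianForce κ 0‖₊) (freePath κ X₀ V₀)
      (Icc (-(n : ℝ)) n) := by
  refine Convex.lipschitzOnWith_of_nnnorm_hasDerivWithin_le (convex_Icc _ _)
    (fun t _ => (hasDerivAt_freePath κ X₀ V₀ t).hasDerivWithinAt) fun t ht => ?_
  refine (nnnorm_add_le _ _).trans (add_le_add le_rfl ?_)
  rw [nnnorm_smul]
  refine mul_le_mul_left ?_ _
  rw [← NNReal.coe_le_coe, coe_nnnorm, Real.norm_eq_abs, NNReal.coe_natCast]
  exact abs_le.mpr ht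

theorem IsProjectedFlow.lipschitzOnWith {κ : ℝ} {X₀ V₀ : LagL2} {X : ℝ → LagL2}
    (hX : IsProjectedFlow κ X₀ V₀ X) (n : ℕ) :
    LipschitzOnWith (‖V₀‖₊ + n * ‖lagrangianForce κ 0‖₊) X (Icc (-(n : ℝ)) n) := by
  rw [isProjectedFlow_iff] at hX
  refine LipschitzOnWith.of_dist_le_mul fun s hs t ht => ?_
  refine le_trans ?_ ((lipschitzOnWith_freePath κ X₀ V₀ n).dist_le_mul s hs t ht)
  rw [dist_eq_norm, dist_eq_norm]
  exact (hX s).norm_sub_le (hX t)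

theorem IsProjectedFlow.continuous {κ : ℝ} {X₀ V₀ : LagL2} {X : ℝ → LagL2}
    (hX : IsProjectedFlow κ X₀ V₀ X) : Continuous X := by
  refine continuous_iff_continuousAt.mpr fun t => ?_
  obtain ⟨n, hn⟩ := exists_nat_gt |t|
  exact (hX.lipschitzOnWith n).continuousOn.continuousAt
    (Icc_mem_nhds (abs_lt.mp hn).1 (abs_lt.mp hn).2)

theorem IsProjectedFlow.ae_differentiableAt {κ : ℝ} {X₀ V₀ : LagL2} {X : ℝ → LagL2}
    (hX : IsProjectedFlow κ X₀ V₀ X) : ∀ᵐ t, DifferentiableAt ℝ X t := by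
  -- Finiteness of the exponent is what makes the L² space separable.
  have : Fact ((2 : ℝ≥0∞) ≠ ⊤) := ⟨ENNReal.ofNat_ne_top⟩
  exact ae_differentiableAt_of_lipschitzOn_Icc fun n => ⟨_, hX.lipschitzOnWith n⟩

theorem exists_isProjectedFlow (κ : ℝ) (X₀ V₀ : LagL2) : ∃ X, IsProjectedFlow κ X₀ V₀ X := by
  choose X hX using fun t => exists_isMetricProjection (freePath κ X₀ V₀ t)
  exact ⟨X, isProjectedFlow_iff.mpr hX⟩

theorem IsProjectedFlow.unique {κ : ℝ} {X₀ V₀ : LagL2} {X X' : ℝ → LagL2}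
    (hX' : IsProjectedFlow κ X₀ V₀ X') (hX : IsProjectedFlow κ X₀ V₀ X) : X' = X :=
  funext fun t => (isProjectedFlow_iff.mp hX' t).eq (isProjectedFlow_iff.mp hX t)

theorem IsProjectedFlow.apply_zero {κ : ℝ} {X₀ V₀ : LagL2} {X : ℝ → LagL2}
    (hX : IsProjectedFlow κ X₀ V₀ X) (h₀ : X₀ ∈ monotoneCone) : X 0 = X₀ := by
  have h := isProjectedFlow_iff.mp hX 0
  have h0 : freePath κ X₀ V₀ 0 = X₀ := by simp [freePath]
  rw [h0] at h
  exact h.eq_of_mem h₀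

/-! ### Orthogonality of the residual and the projected velocity -/

/-- The residual of the projection onto the cone is orthogonal to Lipschitz functions of the
projection. -/
theorem IsMetricProjection.inner_lipschitz_comp_eq_zero {Y P W : LagL2}
    (hP : IsMetricProjection monotoneCone Y P) {g : ℝ → ℝ} {K : ℝ≥0} (hg : LipschitzWith K g)
    (hW : W =ᵐ[refMeasure] fun m => g (P m)) : inner ℝ (Y - P) W = 0 := by
  -- With |c| = 1/(K+1) the slope of c g is below 1 in size, so x + c g(x) is nondecreasing for
  -- either sign of c.
  have hε : (0 : ℝ) < 1 / (K + 1) := by positivity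
  have key {c : ℝ} (hc : |c| = 1 / (K + 1)) : P + c • W ∈ monotoneCone := by
    have hmono : Monotone fun x => x + c * g x := by
      intro x y hxy
      have h1 := hg.dist_le_mul x y
      rw [Real.dist_eq, Real.dist_eq, abs_sub_comm x y, abs_of_nonneg (sub_nonneg.mpr hxy)] at h1
      have h2 : |c * (g x - g y)| ≤ y - x := by
        rw [abs_mul, hc, one_div, inv_mul_le_iff₀ (by positivity)]
        nlinarith
      have h3 := (abs_le.mp h2).2
      simp only
      linarith
    rw [mem_monotoneCone_iff]
    refine ((mem_monotoneCone_iff.mp hP.1).comp hmono).congr ?_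
    filter_upwards [Lp.coeFn_add P (c • W), Lp.coeFn_smul c W, hW] with m h1 h2 h3
    rw [h1, Pi.add_apply, h2, Pi.smul_apply, h3, smul_eq_mul]
    rfl
  refine hP.inner_eq_zero hε (key (abs_of_pos hε)) ?_
  rw [sub_eq_add_neg, ← neg_smul]
  exact key (by rw [abs_neg, abs_of_pos hε])

theorem inner_eq_zero_of_smooth_comp {X W G : LagL2}
    (h : ∀ φ : ℝ → ℝ, ContDiff ℝ ∞ φ → HasCompactSupport φ → ∫ m, φ (X m) * W m ∂refMeasure = 0)
    {u : ℝ → ℝ} (hu : Measurable u) (hG : G =ᵐ[refMeasure] fun m => u (X m)) :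
    inner ℝ W G = 0 := by
  have hmem : MemLp u 2 (refMeasure.map X) := by
    rw [memLp_map_measure_iff hu.aestronglyMeasurable (Lp.aemeasurable_refMeasure X)]
    exact (memLp_congr_ae hG).mp (Lp.memLp G)
  rw [← integral_comp_mul_eq_zero h hmem, L2.inner_def]
  refine integral_congr_ae ?_
  filter_upwards [hG] with m hm
  rw [hm]
  rfl

theorem memLp_smooth_comp {φ : ℝ → ℝ} (hφ : Continuous φ) (hc : HasCompactSupport φ)
    (X : LagL2) : MemLp (fun m => φ (X m)) 2 refMeasure := by
  obtain ⟨C, hC⟩ := hφ.bounded_above_of_compact_support hc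
  exact MemLp.of_bound (hφ.comp_aestronglyMeasurable (Lp.aestronglyMeasurable X)) C
    (Eventually.of_forall fun m => hC _)

/-- The passage from Lipschitz to merely measurable functions of P is essential: it is applied to
derivatives of test functions, which involve the Eulerian velocity. -/
theorem IsMetricProjection.inner_comp_eq_zero {Y P G : LagL2}
    (hP : IsMetricProjection monotoneCone Y P) {u : ℝ → ℝ} (hu : Measurable u)
    (hG : G =ᵐ[refMeasure] fun m => u (P m)) : inner ℝ (Y - P) G = 0 := by
  refine inner_eq_zero_of_smooth_comp (X := P) (fun φ hφ hc => ?_) hu hG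
  obtain ⟨K, hK⟩ := ContDiff.lipschitzWith_of_hasCompactSupport hc hφ (by simp)
  have hm := memLp_smooth_comp hφ.continuous hc P
  rw [← hP.inner_lipschitz_comp_eq_zero hK hm.coeFn_toLp, L2.inner_def]
  refine integral_congr_ae ?_
  filter_upwards [hm.coeFn_toLp] with m h1
  rw [h1]
  rfl

/-- The derivative `∂ₜφ(t, X) + V ∂ₓφ(t, X)` of a test function along a curve. -/
def testDeriv {φ : ℝ × ℝ → ℝ} (hφ : ContDiff ℝ ∞ φ) (hc : HasCompactSupport φ) (t : ℝ)
    (X V : LagL2) : LagL2 := (memLp_fderiv_test_comp hφ hc t X V).toLp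

theorem coeFn_testDeriv {φ : ℝ × ℝ → ℝ} (hφ : ContDiff ℝ ∞ φ) (hc : HasCompactSupport φ) (t : ℝ)
    (X V : LagL2) : testDeriv hφ hc t X V =ᵐ[refMeasure]
      fun m => fderiv ℝ φ (t, X m) (1, V m) :=
  (memLp_fderiv_test_comp hφ hc t X V).coeFn_toLp

theorem measurable_fderiv_test {φ : ℝ × ℝ → ℝ} (hφ : ContDiff ℝ ∞ φ) (t : ℝ) {u : ℝ → ℝ}
    (hu : Measurable u) : Measurable fun x => fderiv ℝ φ (t, x) (1, u x) := by
  have hcont' : Continuous fun q : ℝ × ℝ => fderiv ℝ φ (t, q.1) :=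
    (hφ.continuous_fderiv (by simp)).comp (by fun_prop : Continuous fun q : ℝ × ℝ => (t, q.1))
  have hcont : Continuous fun q : ℝ × ℝ => fderiv ℝ φ (t, q.1) (1, q.2) :=
    hcont'.clm_apply (by fun_prop)
  exact hcont.measurable.comp (measurable_id.prodMk hu)

section differentiability_points

variable {Z X : ℝ → LagL2} {Y V : LagL2} {t : ℝ} {u : ℝ → ℝ}

theorem testDeriv_eq_comp (hV : V =ᵐ[refMeasure] fun m => u (X t m)) {φ : ℝ × ℝ → ℝ}
    (hφ : ContDiff ℝ ∞ φ) (hc : HasCompactSupport φ) :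
    testDeriv hφ hc t (X t) V =ᵐ[refMeasure]
      fun m => (fun x => fderiv ℝ φ (t, x) (1, u x)) (X t m) := by
  filter_upwards [coeFn_testDeriv hφ hc t (X t) V, hV] with m h1 h2
  rw [h1, h2]

/-- At points of differentiability the velocity of the projected curve is the orthogonal
projection of the velocity of the curve onto the functions of its position. -/
theorem inner_velocity_sub_testComp_eq_zero
    (hX : ∀ s, IsMetricProjection monotoneCone (Z s) (X s)) (hZ : HasDerivAt Z Y t)
    (hXt : HasDerivAt X V t) (hu : Measurable u) (hV : V =ᵐ[refMeasure] fun m => u (X t m))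
    {φ : ℝ × ℝ → ℝ} (hφ : ContDiff ℝ ∞ φ) (hc : HasCompactSupport φ) :
    inner ℝ (Y - V) (testComp hφ.continuous hc t (X t)) = 0 := by
  have h0 (s : ℝ) : inner ℝ (Z s - X s) (testComp hφ.continuous hc s (X s)) = 0 :=
    (hX s).inner_comp_eq_zero
      (hφ.continuous.comp (by fun_prop : Continuous fun x : ℝ => (s, x))).measurable
      (coeFn_testComp hφ.continuous hc s (X s))
  have h1 := (hZ.sub hXt).inner ℝ (hXt.testComp hφ hc)
  -- Because V is a function of X t, so is the derivative of the second factor; the residual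
  -- annihilates it.
  have h2 : inner ℝ (Z t - X t) (testDeriv hφ hc t (X t) V) = 0 :=
    (hX t).inner_comp_eq_zero (measurable_fderiv_test hφ t hu) (testDeriv_eq_comp hV hφ hc)
  have h3 := h1.unique ((hasDerivAt_const t (0 : ℝ)).congr_of_eventuallyEq
    (Eventually.of_forall h0))
  simp only [Pi.sub_apply] at h3
  change inner ℝ (Z t - X t) (testDeriv hφ hc t (X t) V) + _ = 0 at h3
  rwa [h2, zero_add] at h3

/-- Orthogonality of Y − V to smooth functions of X t extends by density to the test derivative. The
quadratic flux thus becomes linear in the known curve Y. -/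
theorem inner_velocity_eq (hX : ∀ s, IsMetricProjection monotoneCone (Z s) (X s))
    (hZ : HasDerivAt Z Y t) (hXt : HasDerivAt X V t) (hu : Measurable u)
    (hV : V =ᵐ[refMeasure] fun m => u (X t m)) {φ : ℝ × ℝ → ℝ} (hφ : ContDiff ℝ ∞ φ)
    (hc : HasCompactSupport φ) :
    inner ℝ V (testDeriv hφ hc t (X t) V) = inner ℝ Y (testDeriv hφ hc t (X t) V) := by
  suffices h : inner ℝ (Y - V) (testDeriv hφ hc t (X t) V) = 0 by
    rw [inner_sub_left, sub_eq_zero] at h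
    exact h.symm
  refine inner_eq_zero_of_smooth_comp (X := X t) (fun ψ hψ hψc => ?_)
    (measurable_fderiv_test hφ t hu) (testDeriv_eq_comp hV hφ hc)
  -- A bump in time, equal to 1 at t, turns the spatial function ψ into an admissible space-time
  -- test function.
  let χ : ContDiffBump t := default
  have hχψ : ContDiff ℝ ∞ fun p : ℝ × ℝ => χ p.1 * ψ p.2 :=
    (χ.contDiff.comp contDiff_fst).mul (hψ.comp contDiff_snd)
  have hχψc : HasCompactSupport fun p : ℝ × ℝ => χ p.1 * ψ p.2 := by
    refine HasCompactSupport.intro (χ.hasCompactSupport.isCompact.prod hψc.isCompact)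
      fun p hp => ?_
    rw [mem_prod, not_and_or] at hp
    rcases hp with hp | hp
    · rw [image_eq_zero_of_notMem_tsupport hp, zero_mul]
    · rw [image_eq_zero_of_notMem_tsupport hp, mul_zero]
  rw [← inner_velocity_sub_testComp_eq_zero hX hZ hXt hu hV hχψ hχψc, L2.inner_def]
  refine integral_congr_ae ?_
  filter_upwards [coeFn_testComp hχψ.continuous hχψc t (X t)] with m hm
  rw [hm, χ.one_of_mem_closedBall (Metric.mem_closedBall_self χ.rIn_pos.le), one_mul]
  rfl

end differentiability_points

theorem lipschitzOnWith_testComp {X : ℝ → LagL2} {L K : ℝ≥0} {s : Set ℝ}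
    (hX : LipschitzOnWith L X s) {φ : ℝ × ℝ → ℝ} (hφ : Continuous φ) (hc : HasCompactSupport φ)
    (hK : LipschitzWith K φ) :
    LipschitzOnWith (K + K * L) (fun t => testComp hφ hc t (X t)) s := by
  refine LipschitzOnWith.of_dist_le_mul fun a ha b hb => ?_
  rw [dist_eq_norm]
  refine (norm_testComp_sub_le hφ hc hK a b (X a) (X b)).trans ?_
  have h1 := hX.dist_le_mul a ha b hb
  rw [dist_eq_norm, Real.dist_eq] at h1
  rw [Real.dist_eq]
  push_cast
  nlinarith [K.2]

/-- Integration by parts in time of an affine curve against a test function along a flow. -/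
theorem integral_inner_testDeriv {X : ℝ → LagL2}
    (hXl : ∀ n : ℕ, ∃ L : ℝ≥0, LipschitzOnWith L X (Icc (-(n : ℝ)) n))
    (hXd : ∀ᵐ t, DifferentiableAt ℝ X t) (W F : LagL2) {φ : ℝ × ℝ → ℝ} (hφ : ContDiff ℝ ∞ φ)
    (hc : HasCompactSupport φ) :
    (∫ t in Ici (0 : ℝ), inner ℝ (W + t • F) (testDeriv hφ hc t (X t) (deriv X t))) +
      (∫ t in Ici (0 : ℝ), inner ℝ F (testComp hφ.continuous hc t (X t))) =
      -inner ℝ W (testComp hφ.continuous hc 0 (X 0)) := by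
  obtain ⟨K, hK⟩ := ContDiff.lipschitzWith_of_hasCompactSupport hc hφ (by simp)
  obtain ⟨R, hR⟩ := hc.isCompact.isBounded.subset_closedBall (0 : ℝ × ℝ)
  -- The strict inequality places the time n itself outside the support, so the upper boundary term
  -- vanishes.
  obtain ⟨n, hn⟩ := exists_nat_gt R
  obtain ⟨L, hL⟩ := hXl n
  have hn0 : (0 : ℝ) ≤ n := n.cast_nonneg
  let Θ : ℝ → LagL2 := fun t => testComp hφ.continuous hc t (X t)
  let D : ℝ → LagL2 := fun t => testDeriv hφ hc t (X t) (deriv X t)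
  change (∫ t in Ici (0 : ℝ), inner ℝ (W + t • F) (D t)) +
    (∫ t in Ici (0 : ℝ), inner ℝ F (Θ t)) = -inner ℝ W (Θ 0)
  have hout {t x : ℝ} (ht : (n : ℝ) ≤ t) : (t, x) ∉ tsupport φ := by
    intro h
    have h1 := (mem_closedBall_zero_iff.mp (hR h))
    have h2 : |t| ≤ ‖(t, x)‖ := norm_fst_le (t, x)
    linarith [le_abs_self t]
  have hΘ0 {t : ℝ} (ht : (n : ℝ) ≤ t) : Θ t = 0 := by
    refine Lp.eq_zero_iff_ae_eq_zero.mpr ?_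
    filter_upwards [coeFn_testComp hφ.continuous hc t (X t)] with m hm
    rw [hm, image_eq_zero_of_notMem_tsupport (hout ht)]
    rfl
  have hD0 {t : ℝ} (ht : (n : ℝ) ≤ t) : D t = 0 := by
    refine Lp.eq_zero_iff_ae_eq_zero.mpr ?_
    filter_upwards [coeFn_testDeriv hφ hc t (X t) (deriv X t)] with m hm
    rw [hm, image_eq_zero_of_notMem_tsupport
      (fun h => hout ht (tsupport_fderiv_subset ℝ h))]
    rfl
  have hcut {g : ℝ → ℝ} (hg : ∀ t, (n : ℝ) ≤ t → g t = 0) :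
      ∫ t in Ici (0 : ℝ), g t = ∫ t in (0 : ℝ)..n, g t := by
    rw [intervalIntegral.integral_of_le hn0, integral_Ici_eq_integral_Ioi]
    refine (setIntegral_eq_of_subset_of_forall_sdiff_eq_zero measurableSet_Ioi
      Ioc_subset_Ioi_self fun t ht => hg t ?_)
    by_contra! hlt
    exact ht.2 ⟨ht.1, hlt.le⟩
  have hΘl : LipschitzOnWith (K + K * L) Θ (uIcc 0 (n : ℝ)) := by
    refine (lipschitzOnWith_testComp hL hφ.continuous hc hK).mono ?_
    rw [uIcc_of_le hn0]
    exact Icc_subset_Icc_left (by linarith)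
  have hac (c : LagL2) : AbsolutelyContinuousOnInterval (fun t => inner ℝ c (Θ t)) 0 n :=
    ((innerSL ℝ c).lipschitz.comp_lipschitzOnWith hΘl).absolutelyContinuousOnInterval
  have hid : AbsolutelyContinuousOnInterval (fun t : ℝ => t) 0 n :=
    (LipschitzWith.id.lipschitzOnWith).absolutelyContinuousOnInterval
  -- This is ⟨W + tF, φ(t, X_t)⟩. Its almost everywhere derivative is the sum of the two integrands,
  -- and absolute continuity gives the fundamental theorem of calculus.
  have hG : AbsolutelyContinuousOnInterval (fun t => inner ℝ W (Θ t) + t * inner ℝ F (Θ t)) 0 n :=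
    (hac W).fun_add (hid.fun_mul (hac F))
  have hder : ∀ᵐ t, deriv (fun t => inner ℝ W (Θ t) + t * inner ℝ F (Θ t)) t =
      inner ℝ (W + t • F) (D t) + inner ℝ F (Θ t) := by
    filter_upwards [hXd] with t ht
    have hΘt : HasDerivAt Θ (D t) t := ht.hasDerivAt.testComp hφ hc
    have hin (c : LagL2) : HasDerivAt (fun t => inner ℝ c (Θ t)) (inner ℝ c (D t)) t := by
      simpa using (hasDerivAt_const t c).inner ℝ hΘt
    have := (hin W).add ((hasDerivAt_id t).mul (hin F))
    refine this.deriv.trans ?_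
    rw [inner_add_left, real_inner_smul_left]
    simp only [id_eq]
    ring
  have hΘF : IntervalIntegrable (fun t => inner ℝ F (Θ t)) volume 0 n :=
    (hac F).continuousOn.intervalIntegrable
  have hint := hG.integral_deriv_eq_sub
  have hsub : ∫ t in (0 : ℝ)..n, inner ℝ (W + t • F) (D t) =
      ∫ t in (0 : ℝ)..n, (deriv (fun t => inner ℝ W (Θ t) + t * inner ℝ F (Θ t)) t -
        inner ℝ F (Θ t)) := by
    refine intervalIntegral.integral_congr_ae ?_
    filter_upwards [hder] with t ht _
    rw [ht, add_sub_cancel_right]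
  rw [hcut fun t ht => by rw [hD0 ht, inner_zero_right],
    hcut fun t ht => by rw [hΘ0 ht, inner_zero_right], hsub,
    intervalIntegral.integral_sub hG.intervalIntegrable_deriv hΘF, hint, hΘ0 le_rfl]
  simp

theorem lintegral_enorm_sq_eq (V : LagL2) :
    ∫⁻ m, ‖V m‖ₑ ^ 2 ∂refMeasure = ‖V‖ₑ ^ 2 := by
  have h := eLpNorm_nnreal_pow_eq_lintegral (f := V) (μ := refMeasure) (p := 2) two_ne_zero
  rw [Lp.enorm_def]
  simpa using h.symm

theorem fderiv_apply_one_eq {φ : ℝ × ℝ → ℝ} (hφ : ContDiff ℝ ∞ φ) (t x v : ℝ) :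
    fderiv ℝ φ (t, x) (1, v) =
      deriv (fun s => φ (s, x)) t + v * deriv (fun y => φ (t, y)) x := by
  have hd := (hφ.differentiable (by simp) (t, x)).hasFDerivAt
  have h1 : HasDerivAt (fun s => φ (s, x)) (fderiv ℝ φ (t, x) (1, 0)) t :=
    hd.comp_hasDerivAt t ((hasDerivAt_id t).prodMk (hasDerivAt_const t x))
  have h2 : HasDerivAt (fun y => φ (t, y)) (fderiv ℝ φ (t, x) (0, 1)) x :=
    hd.comp_hasDerivAt x ((hasDerivAt_const x t).prodMk (hasDerivAt_id x))
  rw [h1.deriv, h2.deriv, ← smul_eq_mul v, ← map_smul, ← map_add]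
  simp

/-! ### The Eulerian weak solution -/

section flow

variable {κ : ℝ} {X₀ V₀ : LagL2} {X : ℝ → LagL2}

/-- The Eulerian velocity of a curve of monotone maps. -/
def eulerVelocity (X : ℝ → LagL2) (t x : ℝ) : ℝ :=
  levelVelocity (refMeasure.map (X t)) (deriv X t : LagL2) x

instance isProbabilityMeasure_map_refMeasure (X : LagL2) :
    IsProbabilityMeasure (refMeasure.map X) :=
  Measure.isProbabilityMeasure_map (Lp.aemeasurable_refMeasure X)

theorem isP2_map (X : LagL2) : IsP2 (refMeasure.map X) :=
  ⟨inferInstance, (memLp_map_measure_iff aestronglyMeasurable_id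
    (Lp.aemeasurable_refMeasure X)).mpr (Lp.memLp X)⟩

theorem measurable_eulerVelocity (hX : Continuous X) :
    Measurable fun p : ℝ × ℝ => eulerVelocity X p.1 p.2 := by
  have : Fact ((2 : ℝ≥0∞) ≠ ⊤) := ⟨ENNReal.ofNat_ne_top⟩
  exact measurable_levelVelocity (measurable_map_of_continuous hX) (stronglyMeasurable_deriv X)

theorem measurable_eulerVelocity_right (hX : Continuous X) (t : ℝ) :
    Measurable (eulerVelocity X t) :=
  Measurable.of_uncurry_left (f := eulerVelocity X) (measurable_eulerVelocity hX)

theorem deriv_ae_eq_eulerVelocity (hX : ∀ s, X s ∈ monotoneCone) {t : ℝ}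
    (ht : DifferentiableAt ℝ X t) :
    (deriv X t : LagL2) =ᵐ[refMeasure] fun m => eulerVelocity X t (X t m) :=
  (levelVelocity_comp_ae_eq (mem_monotoneCone_iff.mp (hX t)) (Lp.aemeasurable_refMeasure _)
    (ht.hasDerivAt.constOnLevels hX)).mono fun _ hm => hm.symm

theorem memLp_eulerVelocity (hXc : Continuous X) (hX : ∀ s, X s ∈ monotoneCone) {t : ℝ}
    (ht : DifferentiableAt ℝ X t) : MemLp (eulerVelocity X t) 2 (refMeasure.map (X t)) := by
  rw [memLp_map_measure_iff (measurable_eulerVelocity_right hXc t).aestronglyMeasurable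
    (Lp.aemeasurable_refMeasure _)]
  exact (memLp_congr_ae (deriv_ae_eq_eulerVelocity hX ht)).mp (Lp.memLp _)

/-- The weight w = 1 yields the transport term of the mass equation, and w equal to the velocity
yields the momentum flux. -/
theorem integral_testDeriv_map (hXc : Continuous X) (hX : ∀ s, X s ∈ monotoneCone) {t : ℝ}
    (ht : DifferentiableAt ℝ X t) {φ : ℝ × ℝ → ℝ} (hφ : ContDiff ℝ ∞ φ)
    (hc : HasCompactSupport φ) {w : ℝ → ℝ} (hw : Measurable w) {W : LagL2}
    (hW : W =ᵐ[refMeasure] fun m => w (X t m)) :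
    ∫ x, (deriv (fun s => φ (s, x)) t + eulerVelocity X t x * deriv (fun y => φ (t, y)) x) * w x
      ∂(refMeasure.map (X t)) = inner ℝ W (testDeriv hφ hc t (X t) (deriv X t)) := by
  simp_rw [← fderiv_apply_one_eq hφ]
  have hv := deriv_ae_eq_eulerVelocity hX ht
  have hm : Measurable fun x => fderiv ℝ φ (t, x) (1, eulerVelocity X t x) * w x :=
    (measurable_fderiv_test hφ t (measurable_eulerVelocity_right hXc t)).mul hw
  rw [integral_map (Lp.aemeasurable_refMeasure _) hm.aestronglyMeasurable, L2.inner_def]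
  refine integral_congr_ae ?_
  filter_upwards [testDeriv_eq_comp hv hφ hc, hW] with m h1 h2
  rw [h1, h2]
  rfl

theorem inner_testComp_eq (W : LagL2) {φ : ℝ × ℝ → ℝ} (hφ : Continuous φ)
    (hc : HasCompactSupport φ) (t : ℝ) (X : LagL2) {w : ℝ → ℝ} (hW : W =ᵐ[refMeasure] w) :
    inner ℝ W (testComp hφ hc t X) = ∫ m, φ (t, X m) * w m ∂refMeasure := by
  rw [L2.inner_def]
  refine integral_congr_ae ?_
  filter_upwards [coeFn_testComp hφ hc t X, hW] with m h1 h2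
  rw [h1, h2]
  rfl

theorem IsProjectedFlow.isWeakSolutionEP (hX : IsProjectedFlow κ X₀ V₀ X)
    (h₀ : X₀ ∈ monotoneCone) {v₀ : ℝ → ℝ} (hv₀ : AEStronglyMeasurable v₀ (refMeasure.map X₀))
    (hV₀ : V₀ =ᵐ[refMeasure] fun m => v₀ (X₀ m)) :
    IsWeakSolutionEP κ (refMeasure.map X₀) v₀ (fun t => refMeasure.map (X t))
      (eulerVelocity X) := by
  have hP := isProjectedFlow_iff.mp hX
  have hXcone (s : ℝ) : X s ∈ monotoneCone := (hP s).1
  have hXc := hX.continuous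
  have hXl (n : ℕ) : ∃ L : ℝ≥0, LipschitzOnWith L X (Icc (-(n : ℝ)) n) := ⟨_, hX.lipschitzOnWith n⟩
  have hXd := hX.ae_differentiableAt
  have hX0 := hX.apply_zero h₀
  have hXm (t : ℝ) : Measurable (X t) := (Lp.stronglyMeasurable (X t)).measurable
  have hρm : Measurable fun t : Ici (0 : ℝ) => refMeasure.map (X t) :=
    (measurable_map_of_continuous hXc).comp measurable_subtype_coe
  have hincl : Measurable fun p : Ici (0 : ℝ) × ℝ => ((p.1 : ℝ), p.2) := by fun_prop
  have hvm : Measurable fun p : Ici (0 : ℝ) × ℝ => eulerVelocity X p.1 p.2 := by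
    have := (measurable_eulerVelocity hXc).comp hincl
    simpa only [Function.comp_def] using this
  refine ⟨fun t _ => isP2_map (X t), hρm, hvm, fun T => ?_, fun t _ => isPoissonForce_of_isP2 κ (isP2_map (X t)), fun φ hφ hc => ?_,
    fun ζ hζ hc => ?_⟩
  · obtain ⟨n, hn⟩ := exists_nat_gt T
    obtain ⟨L, hL⟩ := hXl n
    have hbd : ∀ᵐ t ∂(volume.restrict (Icc 0 T)),
        ∫⁻ x, ‖eulerVelocity X t x‖ₑ ^ 2 ∂(refMeasure.map (X t)) ≤ (L : ℝ≥0∞) ^ 2 := by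
      filter_upwards [ae_restrict_of_ae hXd, ae_restrict_mem measurableSet_Icc] with t ht htT
      have hlt : -(n : ℝ) < t := by linarith [htT.1, htT.2]
      rw [lintegral_map ((measurable_eulerVelocity_right hXc t).enorm.pow_const 2) (hXm t)]
      have heq : ∫⁻ m, ‖eulerVelocity X t (X t m)‖ₑ ^ 2 ∂refMeasure = ‖deriv X t‖ₑ ^ 2 := by
        rw [← lintegral_enorm_sq_eq]
        refine lintegral_congr_ae ?_
        filter_upwards [deriv_ae_eq_eulerVelocity hXcone ht] with m hm
        rw [hm]
      rw [heq]
      gcongr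
      rw [enorm_le_coe, ← NNReal.coe_le_coe, coe_nnnorm]
      exact norm_deriv_le_of_lipschitzOn (Icc_mem_nhds hlt (htT.2.trans_lt hn)) hL
    refine (lintegral_mono_ae hbd).trans_lt ?_
    rw [lintegral_const, Measure.restrict_apply_univ]
    exact ENNReal.mul_lt_top (ENNReal.pow_lt_top ENNReal.coe_lt_top) measure_Icc_lt_top
  · let o : LagL2 := Lp.const 2 refMeasure (1 : ℝ)
    have ho : o =ᵐ[refMeasure] fun _ => 1 := Lp.coeFn_const ..
    -- Mass conservation is the integration by parts for the constant curve 1, with zero slope.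
    have hibp := integral_inner_testDeriv hXl hXd o 0 hφ hc
    simp only [smul_zero, add_zero, inner_zero_left, integral_zero] at hibp
    rw [hX0, inner_testComp_eq o hφ.continuous hc 0 X₀ ho] at hibp
    have hφm : Continuous fun x : ℝ => φ (0, x) :=
      hφ.continuous.comp (by fun_prop : Continuous fun x : ℝ => ((0 : ℝ), x))
    rw [integral_map (Lp.aemeasurable_refMeasure X₀) hφm.aestronglyMeasurable]
    simp only [mul_one] at hibp
    rw [← hibp]
    refine setIntegral_congr_ae measurableSet_Ici ?_
    filter_upwards [hXd] with t ht _
    rw [← integral_testDeriv_map hXc hXcone ht hφ hc (w := fun _ => 1) measurable_const ho]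
    simp only [mul_one]
  · have hF := (memLp_lagrangianForce κ).coeFn_toLp
    have hibp := integral_inner_testDeriv hXl hXd V₀ (lagrangianForce κ 0) hζ hc
    rw [hX0, inner_testComp_eq V₀ hζ.continuous hc 0 X₀ hV₀] at hibp
    have hζm (t : ℝ) : Continuous fun x : ℝ => ζ (t, x) :=
      hζ.continuous.comp (by fun_prop : Continuous fun x : ℝ => (t, x))
    have hζv : AEStronglyMeasurable (fun x => ζ (0, x) * v₀ x) (refMeasure.map X₀) :=
      (hζm 0).aestronglyMeasurable.mul hv₀
    rw [integral_map (Lp.aemeasurable_refMeasure X₀) hζv, ← hibp]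
    congr 1
    · refine setIntegral_congr_ae measurableSet_Ici ?_
      filter_upwards [hXd] with t ht _
      have hv := deriv_ae_eq_eulerVelocity hXcone ht
      have hvm := measurable_eulerVelocity_right hXc t
      rw [integral_testDeriv_map hXc hXcone ht hζ hc hvm hv]
      -- Here the actual velocity is exchanged for V₀ + tF, the affine curve that was integrated by
      -- parts.
      exact inner_velocity_eq hP (hasDerivAt_freePath κ X₀ V₀ t) ht.hasDerivAt hvm hv hζ hc
    · refine integral_congr_ae (Eventually.of_forall fun t => ?_)
      obtain ⟨C, hC⟩ := hζ.continuous.bounded_above_of_compact_support hc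
      simp only
      rw [inner_testComp_eq (lagrangianForce κ 0) hζ.continuous hc t (X t) hF]
      exact integral_mul_forceDensity κ (mem_monotoneCone_iff.mp (hXcone t)) (hXm t)
        (hζm t).measurable (fun x => hC (t, x))

end flow

end

theorem theorem4p2 (κ : ℝ) (hκ : κ = 1 ∨ κ = -1)
    (ρ₀ : Measure ℝ) (hρ₀ : IsP2 ρ₀) (v₀ : ℝ → ℝ) (hv₀ : MemLp v₀ 2 ρ₀) :
    -- the initial monotone transport exists and is unique
    (∃! X₀ : LagL2, X₀ ∈ monotoneCone ∧ refMeasure.map X₀ = ρ₀) ∧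
    ∀ X₀ : LagL2, X₀ ∈ monotoneCone → refMeasure.map X₀ = ρ₀ →
      ∃ V₀ : LagL2, V₀ =ᵐ[refMeasure] (fun m => v₀ (X₀ m)) ∧
      -- the curve of projections exists and is unique
      ∃ X : ℝ → LagL2, IsProjectedFlow κ X₀ V₀ X ∧
        (∀ X' : ℝ → LagL2, IsProjectedFlow κ X₀ V₀ X' → X' = X) ∧
        (∀ᵐ t ∂(volume.restrict (Ici (0 : ℝ))), DifferentiableAt ℝ X t) ∧
        ∃ v : ℝ → ℝ → ℝ,
          (∀ᵐ t ∂(volume.restrict (Ici (0 : ℝ))),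
            MemLp (v t) 2 (refMeasure.map (X t)) ∧
            (fun m => (deriv X t : LagL2) m) =ᵐ[refMeasure] (fun m => v t (X t m))) ∧
          IsWeakSolutionEP κ ρ₀ v₀ (fun t => refMeasure.map (X t)) v := by
  refine ⟨existsUnique_monotone_transport hρ₀, fun X₀ h₀ hmap => ?_⟩
  subst hmap
  have hmem : MemLp (v₀ ∘ X₀) 2 refMeasure :=
    (memLp_map_measure_iff hv₀.1 (Lp.aemeasurable_refMeasure X₀)).mp hv₀
  obtain ⟨X, hX⟩ := exists_isProjectedFlow κ X₀ hmem.toLp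
  have hd := ae_restrict_of_ae (s := Ici (0 : ℝ)) hX.ae_differentiableAt
  have hcone (s : ℝ) : X s ∈ monotoneCone := (isProjectedFlow_iff.mp hX s).1
  refine ⟨hmem.toLp, hmem.coeFn_toLp, X, hX, fun X' hX' => hX'.unique hX, hd,
    eulerVelocity X, ?_, hX.isWeakSolutionEP h₀ hv₀.1 hmem.coeFn_toLp⟩
  filter_upwards [hd] with t ht
  exact ⟨memLp_eulerVelocity hX.continuous hcone ht, deriv_ae_eq_eulerVelocity hcone ht⟩
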